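/- **Conventions.** Let $G$ be a discrete group. A $G$-simplicial set is a simplicial set $X$ with a left $G$-action by simplicial maps; for a subgroup $H\subseteq G$, $X^H$ is the simplicial subset of $H$-fixed simplices. $X$ is a *$G$-Kan complex* if $X^H$ is a Kan complex for every subgroup $H$, and it is *one-vertex* if $X_0=\{v\}$ has exactly one element (so $v$ is $G$-fixed and every $X^H$ has $v$ as its only vertex). $O_G$ is the category with objects the $G$-sets $G/H$, $H\subseteq G$ a subgroup, and morphisms the $G$-maps; a $G$-map $\hat g:G/H\to G/K$ with $\hat g(eH)=gK$ induces $g:X^K\to X^H$, $x\mapsto gx$. On $\Delta[n]$, $\delta_i$ and $\sigma_i$ denote the coface and codegeneracy maps. The group $G$ acts on $G/H\times\Delta[n]$ through the first factor only, and an *equivariant $n$-simplex of type $H$* of $X$ is a $G$-map $\sigma:G/H\times\Delta[n]\to X$; these correspond bijectively to the $n$-simplices $\sigma'=\sigma(eH,\mathrm{id}_{[n]})$ of $X^H$, and $\sigma$ is called degenerate if $\sigma'$ is degenerate in $X^H$. Its faces are $\sigma^{(j)}=\sigma\circ(\mathrm{id}\times\delta_j)$. **The fundamental groupoid.** For a $G$-Kan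 complex $X$, the objects of the category $\Pi X$ are the equivariant $0$-simplices $x_H:G/H\times\Delta[0]\to X$ of all types. A morphism $x_H\to y_K$ is a class $[\hat g,\phi]$ of pairs consisting of a $G$-map $\hat g:G/H\to G/K$ and an equivariant $1$-simplex $\phi$ of type $H$ with $\phi\circ(\mathrm{id}\times\delta_1)=x_H$ and $\phi\circ(\mathrm{id}\times\delta_0)=y_K\circ(\hat g\times\mathrm{id})$; two pairs $(\hat g_1,\phi_1)$, $(\hat g_2,\phi_2)$ are equivalent if $\hat g_1=\hat g_2$ and $\phi_1,\phi_2$ are $G$-homotopic relative to $G/H\times\partial\Delta[1]$. The composite of $[\hat g_1,\phi_1]:x_H\to y_K$ followed by $[\hat g_2,\phi_2]:y_K\to z_L$ is $[\hat g_2\circ\hat g_1,\ \xi\circ(\mathrm{id}\times\delta_1)]$, where $\xi$ is any equivariant $2$-simplex of type $H$ with $\xi\circ(\mathrm{id}\times\delta_2)=\phi_1$ and $\xi\circ(\mathrm{id}\times\delta_0)=\phi_2\circ(\hat g_1\times\mathrm{id})$. An *equivariant local coefficient system* on $X$ is a contravariant functor $M$ from $\Pi X$ to abelian groups. **Simplicial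 Bredon–Illman cohomology.** For an equivariant $n$-simplex $\sigma$ of type $H$ let $\sigma_H$ be its restriction to the vertex $0$ of $\Delta[n]$, an object of $\Pi X$; then $\sigma^{(j)}_H=\sigma_H$ for $j>0$. For $n\ge 1$ let $\sigma_*=[\mathrm{id},\alpha]:\sigma_H\to\sigma^{(0)}_H$, where $\alpha$ is the restriction of $\sigma$ to the edge of $\Delta[n]$ from $0$ to $1$. Let $C^n_G(X;M)$ be the group of functions $f$ assigning to every equivariant $n$-simplex $\sigma$ of any type $H$ an element $f(\sigma)\in M(\sigma_H)$, with $f(\sigma)=0$ if $\sigma$ is degenerate, and put, for an equivariant $(n+1)$-simplex $\sigma$, $$(\delta f)(\sigma)=M(\sigma_*)f(\sigma^{(0)})+\sum_{j=1}^{n+1}(-1)^jf(\sigma^{(j)}).$$ Let $S^n_G(X;M)\subseteq C^n_G(X;M)$ be the subgroup of those $f$ such that $f(\eta)=M(g_*)f(\tau)$ whenever $\eta,\tau$ are equivariant $n$-simplices of types $H,K$ and $\hat g:G/H\to G/K$ is a $G$-map with $\eta=\tau\circ(\hat g\times\mathrm{id})$; here $g_*=[\hat g,\eta_H\circ(\mathrm{id}\times\sigma_0)]:\eta_H\to\tau_K$.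 These groups form a cochain complex, and $H^n_G(X;M):=H^n(S^*_G(X;M),\delta)$. **The universal $O_G$-covering complex.** Let $Y$ be a Kan complex with a unique vertex $v$, and let $\pi_1(Y,v)$ be the group of homotopy classes $[y]$ relative to $\partial\Delta[1]$ of $1$-simplices $y$, with $[\partial_0s]\,[\partial_2s]=[\partial_1s]$ for every $2$-simplex $s$. The universal covering complex $\widetilde Y$ has $\widetilde Y_n=\pi_1(Y,v)\times Y_n$ with $\partial_i(\gamma,y)=(\gamma,\partial_iy)$ for $i>0$, $\partial_0(\gamma,y)=([\partial_2\partial_3\cdots\partial_ny]\gamma,\ \partial_0y)$ and $s_i(\gamma,y)=(\gamma,s_iy)$, and $\alpha\in\pi_1(Y,v)$ acts on it by $\alpha\cdot(\gamma,y)=(\gamma\alpha^{-1},y)$. For a one-vertex $G$-Kan complex $X$, the contravariant functor $\widetilde X$ on $O_G$ sends $G/H$ to $\widetilde{X^H}$ and $\hat a:G/H\to G/K$ to $\tilde a(\gamma,x)=(a_*\gamma,ax)$. Let $\underline{C}_n(\widetilde X)(G/H)$ be the free abelian group on the nondegenerate $n$-simplices of $\widetilde{X^H}$, with the usual boundary $\partial=\sum_j(-1)^j\partial_j$,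 where degenerate simplices count as $0$; it is a contravariant functor of $G/H$, acted on by the groups $\pi_1(X^H,v)$. Let $v_H$ be the object of $\Pi X$ of type $H$ with value $v$, and for $\hat g:G/H\to G/K$ let $[\hat g,k]:v_H\to v_K$ be given by $k(eH,\mathrm{id}_{[1]})=s_0v$. Put $M_0(G/H)=M(v_H)$ and $M_0(\hat g)=M([\hat g,k])$. There is a homomorphism $b:\pi_1(X^H,v)\to\mathrm{Aut}_{\Pi X}(v_H)$, $[\phi']\mapsto[\mathrm{id},\phi]$, and $\gamma\in\pi_1(X^H,v)$ acts on $M_0(G/H)$ by $M(b\gamma)^{-1}$. Let $\mathrm{Hom}_{\underline\pi X}(\underline{C}_n(\widetilde X),M_0)$ be the group of natural transformations $\underline{C}_n(\widetilde X)\to M_0$ whose component at every $G/H$ is $\pi_1(X^H,v)$-equivariant, with coboundary $\delta f=f\circ\partial$, and let $H^n_{\underline\pi X,G}(\widetilde X;M_0)$ be the $n$-th cohomology group of this cochain complex. **Theorem.** Let $G$ be a discrete group, $X$ a one-vertex $G$-Kan complex and $M$ an equivariant local coefficient system on $X$. Then for every $n\ge 0$ there is an isomorphism of abelian groups $$H^n_G(X;M)\;\cong\;H^n_{\underline\pi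 X,G}(\widetilde X;M_0).$$ -/

import Mathlib

open CategoryTheory Opposite Simplicial MonoidalCategory

universe u

set_option linter.unusedVariables false
set_option linter.unusedSectionVars false

namespace BredonIllman

/-- Horn filling in a Kan complex, in terms of simplices and their faces. -/
lemma exists_filler (Y : SSet.{u}) [SSet.KanComplex Y] {n : ℕ} (i : Fin (n + 3))
    (a : Fin (n + 3) → Y _⦋n + 1⦌)
    (h : ∀ j k : Fin (n + 3), j ≠ i → k ≠ i → ∀ hjk : j < k,
      Y.δ (k.pred (Fin.ne_zero_of_lt hjk)) (a j) = Y.δ (j.castPred (Fin.ne_last_of_lt hjk)) (a k)) :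
    ∃ s : Y _⦋n + 2⦌, ∀ j, j ≠ i → Y.δ j s = a j := by
  have hf : SSet.horn.IsCompatible (X := Y) (i := i)
      (fun j _ => SSet.yonedaEquiv.symm (a j)) := by
    intro j k hj hk hjk
    rw [SSet.stdSimplex.δ_comp_yonedaEquiv_symm, SSet.stdSimplex.δ_comp_yonedaEquiv_symm,
      h j k hj hk hjk]
  obtain ⟨φ, hφ⟩ := hf.exists_lift_of_kanComplex
  refine ⟨SSet.yonedaEquiv φ, fun j hj => ?_⟩
  rw [← SSet.stdSimplex.yonedaEquiv_δ_comp, hφ j hj, Equiv.apply_symm_apply]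

section Kan

variable {Y : SSet.{u}}

lemma δδ (i j : Fin 2) (h : i ≤ j) (s : Y _⦋2⦌) :
    Y.δ i (Y.δ j.succ s) = Y.δ j (Y.δ i.castSucc s) := SSet.δ_comp_δ_apply h s

variable [SSet.KanComplex Y] {x₀ x₁ x₂ x₃ : Y _⦋0⦌}

lemma fill21 (e₀₁ : SSet.Edge x₀ x₁) (e₁₂ : SSet.Edge x₁ x₂) :
    Nonempty (Σ e₀₂ : SSet.Edge x₀ x₂, SSet.Edge.CompStruct e₀₁ e₁₂ e₀₂) := by
  obtain ⟨s, hs⟩ := exists_filler Y 1 ![e₁₂.edge, e₁₂.edge, e₀₁.edge] (by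
    intro j k hj hk hjk
    fin_cases j <;> fin_cases k <;>
      try first | (exact absurd rfl hj) | (exact absurd rfl hk) | (exact absurd hjk (by decide))
    · exact e₁₂.src_eq.trans e₀₁.tgt_eq.symm)
  have h0 : Y.δ 0 s = e₁₂.edge := hs 0 (by decide)
  have h2 : Y.δ 2 s = e₀₁.edge := hs 2 (by decide)
  refine ⟨⟨SSet.Edge.mk (Y.δ 1 s) ?_ ?_, SSet.Edge.CompStruct.mk s h2 h0 rfl⟩⟩
  · rw [← e₀₁.src_eq, ← h2]; exact (δδ 1 1 le_rfl s).symm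
  · rw [← e₁₂.tgt_eq, ← h0]; exact (δδ 0 0 le_rfl s)

lemma fill20 (e₀₁ : SSet.Edge x₀ x₁) (e₀₂ : SSet.Edge x₀ x₂) :
    Nonempty (Σ e₁₂ : SSet.Edge x₁ x₂, SSet.Edge.CompStruct e₀₁ e₁₂ e₀₂) := by
  obtain ⟨s, hs⟩ := exists_filler Y 0 ![e₀₂.edge, e₀₂.edge, e₀₁.edge] (by
    intro j k hj hk hjk
    fin_cases j <;> fin_cases k <;>
      try first | (exact absurd rfl hj) | (exact absurd rfl hk) | (exact absurd hjk (by decide))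
    · exact e₀₂.src_eq.trans e₀₁.src_eq.symm)
  have h1 : Y.δ 1 s = e₀₂.edge := hs 1 (by decide)
  have h2 : Y.δ 2 s = e₀₁.edge := hs 2 (by decide)
  refine ⟨⟨SSet.Edge.mk (Y.δ 0 s) ?_ ?_, SSet.Edge.CompStruct.mk s h2 rfl h1⟩⟩
  · rw [← e₀₁.tgt_eq, ← h2]; exact (δδ 0 1 (by decide) s).symm
  · rw [← e₀₂.tgt_eq, ← h1]; exact (δδ 0 0 le_rfl s).symm

variable {e₀₁ : SSet.Edge x₀ x₁} {e₁₂ : SSet.Edge x₁ x₂} {e₂₃ : SSet.Edge x₂ x₃}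
      {e₀₂ : SSet.Edge x₀ x₂} {e₁₃ : SSet.Edge x₁ x₃} {e₀₃ : SSet.Edge x₀ x₃}

lemma fill31 (f₃ : SSet.Edge.CompStruct e₀₁ e₁₂ e₀₂) (f₀ : SSet.Edge.CompStruct e₁₂ e₂₃ e₁₃)
    (f₂ : SSet.Edge.CompStruct e₀₁ e₁₃ e₀₃) : Nonempty (SSet.Edge.CompStruct e₀₂ e₂₃ e₀₃) := by
  obtain ⟨s, hs⟩ := exists_filler Y 1 ![f₀.simplex, f₀.simplex, f₂.simplex, f₃.simplex] (by
    intro j k hj hk hjk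
    fin_cases j <;> fin_cases k <;>
      try first | (exact absurd rfl hj) | (exact absurd rfl hk) | (exact absurd hjk (by decide))
    · exact f₀.d₁.trans f₂.d₀.symm
    · exact f₀.d₂.trans f₃.d₀.symm
    · exact f₂.d₂.trans f₃.d₂.symm)
  have h0 : Y.δ 0 s = f₀.simplex := hs 0 (by decide)
  have h2 : Y.δ 2 s = f₂.simplex := hs 2 (by decide)
  have h3 : Y.δ 3 s = f₃.simplex := hs 3 (by decide)
  refine ⟨SSet.Edge.CompStruct.mk (Y.δ 1 s) ?_ ?_ ?_⟩
  · rw [← f₃.d₁, ← h3]; exact (SSet.δ_comp_δ_apply (i := 1) (j := 2) (by decide) s).symm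
  · rw [← f₀.d₀, ← h0]; exact (SSet.δ_comp_δ_apply (i := 0) (j := 0) (by decide) s)
  · rw [← f₂.d₁, ← h2]; exact (SSet.δ_comp_δ_apply (i := 1) (j := 1) (by decide) s).symm

lemma fill32 (f₃ : SSet.Edge.CompStruct e₀₁ e₁₂ e₀₂) (f₀ : SSet.Edge.CompStruct e₁₂ e₂₃ e₁₃)
    (f₁ : SSet.Edge.CompStruct e₀₂ e₂₃ e₀₃) : Nonempty (SSet.Edge.CompStruct e₀₁ e₁₃ e₀₃) := by
  obtain ⟨s, hs⟩ := exists_filler Y 2 ![f₀.simplex, f₁.simplex, f₀.simplex, f₃.simplex] (by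
    intro j k hj hk hjk
    fin_cases j <;> fin_cases k <;>
      try first | (exact absurd rfl hj) | (exact absurd rfl hk) | (exact absurd hjk (by decide))
    · exact f₀.d₀.trans f₁.d₀.symm
    · exact f₀.d₂.trans f₃.d₀.symm
    · exact f₁.d₂.trans f₃.d₁.symm)
  have h0 : Y.δ 0 s = f₀.simplex := hs 0 (by decide)
  have h1 : Y.δ 1 s = f₁.simplex := hs 1 (by decide)
  have h3 : Y.δ 3 s = f₃.simplex := hs 3 (by decide)
  refine ⟨SSet.Edge.CompStruct.mk (Y.δ 2 s) ?_ ?_ ?_⟩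
  · rw [← f₃.d₂, ← h3]; exact (SSet.δ_comp_δ_apply (i := 2) (j := 2) (by decide) s).symm
  · rw [← f₀.d₁, ← h0]; exact (SSet.δ_comp_δ_apply (i := 0) (j := 1) (by decide) s)
  · rw [← f₁.d₁, ← h1]; exact (SSet.δ_comp_δ_apply (i := 1) (j := 1) (by decide) s)

instance (Y : SSet.{u}) [SSet.KanComplex Y] :
    SSet.Truncated.Quasicategory₂ ((SSet.truncation 2).obj Y) where
  fill21 e₀₁ e₁₂ := fill21 (Y := Y) e₀₁ e₁₂
  fill31 f₃ f₀ f₂ := fill31 (Y := Y) f₃ f₀ f₂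
  fill32 f₃ f₀ f₁ := fill32 (Y := Y) f₃ f₀ f₁

end Kan

/-- The fundamental groupoid of a Kan complex: the objects are the `0`-simplices and the morphisms
are the homotopy classes of `1`-simplices relative to the boundary; the composite of the classes
of `e₀₁` and `e₁₂` is the class of the remaining face of a `2`-simplex with faces
`∂₂ = e₀₁` and `∂₀ = e₁₂`. -/
abbrev FundamentalGroupoid₀ (Y : SSet.{u}) [SSet.KanComplex Y] : Type u :=
  SSet.Truncated.HomotopyCategory₂ ((SSet.truncation 2).obj Y)

section
variable (Y : SSet.{u}) [SSet.KanComplex Y]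

/-- A `0`-simplex as an object of the fundamental groupoid. -/
abbrev fpt (x : Y _⦋0⦌) : FundamentalGroupoid₀ Y := ⟨x⟩

variable {Y}
/-- The class of a `1`-simplex. -/
def edgeClass {x y : Y _⦋0⦌} (e : SSet.Edge x y) : fpt Y x ⟶ fpt Y y :=
  SSet.Truncated.HomotopyCategory₂.homMk e.toTruncated

lemma edgeClass_surjective {x y : Y _⦋0⦌} (f : fpt Y x ⟶ fpt Y y) : ∃ e, edgeClass e = f :=
  SSet.Truncated.HomotopyCategory₂.homMk_surjective f

lemma edgeClass_comp_iff {x y z : Y _⦋0⦌} (e : SSet.Edge x y) (e' : SSet.Edge y z)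
    (e'' : SSet.Edge x z) : edgeClass e ≫ edgeClass e' = edgeClass e'' ↔
      Nonempty (SSet.Edge.CompStruct e e' e'') :=
  SSet.Truncated.Edge.CompStruct.nonempty_iff.symm

lemma edgeClass_id (x : Y _⦋0⦌) : edgeClass (SSet.Edge.id x) = 𝟙 _ := rfl

lemma edgeClass_eq_iff {x y : Y _⦋0⦌} (e e' : SSet.Edge x y) :
    edgeClass e = edgeClass e' ↔ Nonempty (SSet.Edge.CompStruct e (SSet.Edge.id y) e') := by
  rw [← edgeClass_comp_iff, edgeClass_id, Category.comp_id]

instance : IsGroupoid (FundamentalGroupoid₀ Y) where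
  all_isIso {x y} f := by
    obtain ⟨e, rfl⟩ := edgeClass_surjective (x := x.pt) (y := y.pt) f
    obtain ⟨⟨e', h⟩⟩ := fill20 e (SSet.Edge.id _)
    obtain ⟨⟨e'', h'⟩⟩ := fill20 e' (SSet.Edge.id _)
    have h1 : edgeClass e ≫ edgeClass e' = 𝟙 _ := (edgeClass_comp_iff _ _ _).2 ⟨h⟩
    have h2 : edgeClass e' ≫ edgeClass e'' = 𝟙 _ := (edgeClass_comp_iff _ _ _).2 ⟨h'⟩
    have : edgeClass e'' = edgeClass e := by
      rw [← Category.id_comp (edgeClass e''), ← h1, Category.assoc, h2, Category.comp_id]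
    exact ⟨edgeClass e', h1, this ▸ h2⟩
lemma exists_comp_iff {Y : SSet.{u}} [SSet.KanComplex Y] {a b c : Y _⦋0⦌} (e : SSet.Edge a b)
    (e' : SSet.Edge b c) (e'' : SSet.Edge a c) : edgeClass e ≫ edgeClass e' = edgeClass e'' ↔
      ∃ s : Y _⦋2⦌, Y.δ 2 s = e.edge ∧ Y.δ 0 s = e'.edge ∧ Y.δ 1 s = e''.edge := by
  rw [edgeClass_comp_iff]
  exact ⟨fun ⟨s⟩ => ⟨s.simplex, s.d₂, s.d₀, s.d₁⟩, fun ⟨s, h₁, h₂, h₃⟩ => ⟨.mk s h₁ h₂ h₃⟩⟩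
end

section Homotopy
open CartesianMonoidalCategory
variable {Y : SSet.{u}}

/-- Two `1`-simplices `a, b : Δ[1] ⟶ Y` are homotopic relative to `∂Δ[1]`. -/
def PathHomotopic (a b : Δ[1] ⟶ Y) : Prop :=
  ∃ F : Δ[1] ⊗ Δ[1] ⟶ Y, SSet.ι₀ ≫ F = a ∧ SSet.ι₁ ≫ F = b ∧
    SSet.Subcomplex.ι (SSet.boundary 1) ▷ Δ[1] ≫ F =
      fst _ _ ≫ SSet.Subcomplex.ι (SSet.boundary 1) ≫ a

/-- The `i`-th vertical side of the square. -/
def side (i : Fin 2) : (Δ[1] : SSet.{u}) ⟶ Δ[1] ⊗ Δ[1] :=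
  lift (SSet.const (SSet.stdSimplex.obj₀Equiv.symm i)) (𝟙 _)

lemma const_mem_boundary (i : Fin 2) (q : SimplexCategoryᵒᵖ) :
    SSet.stdSimplex.const 1 i q ∈ (SSet.boundary.{u} 1).obj q := by
  intro h
  obtain ⟨j, hj⟩ := h (i + 1)
  have : i = i + 1 := hj
  revert this; fin_cases i <;> decide

lemma eq_const_of_mem_boundary {q : SimplexCategoryᵒᵖ} {u : (Δ[1] : SSet.{u}).obj q}
    (hu : u ∈ (SSet.boundary.{u} 1).obj q) : ∃ i, u = SSet.stdSimplex.const 1 i q := by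
  have hu' : ¬ Function.Surjective (SSet.stdSimplex.asOrderHom u) := hu
  simp only [Function.Surjective, not_forall, not_exists] at hu'
  obtain ⟨j, hj⟩ := hu'
  refine ⟨j + 1, ?_⟩
  apply SSet.stdSimplex.objEquiv.injective
  ext k
  have := hj k
  change (SSet.stdSimplex.asOrderHom u k).val = _
  change (SSet.stdSimplex.asOrderHom u k).val = (j + 1).val
  exact congrArg Fin.val ((by decide : ∀ z j : Fin 2, z ≠ j → z = j + 1) _ _ this)

lemma rel_iff (F : Δ[1] ⊗ Δ[1] ⟶ Y) (a : Δ[1] ⟶ Y) :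
    SSet.Subcomplex.ι (SSet.boundary 1) ▷ Δ[1] ≫ F =
      fst _ _ ≫ SSet.Subcomplex.ι (SSet.boundary 1) ≫ a ↔
    ∀ i : Fin 2, side i ≫ F = SSet.const (a.app _ (SSet.stdSimplex.obj₀Equiv.symm i)) := by
  have key : ∀ (i : Fin 2) (q), a.app q (SSet.stdSimplex.const 1 i q) =
      (SSet.const (X := Δ[1]) (a.app _ (SSet.stdSimplex.obj₀Equiv.symm i))).app q 
        (SSet.stdSimplex.const 1 i q) := by
    intro i q
    exact (NatTrans.naturality_apply a (q.unop.const _ 0).op (SSet.stdSimplex.obj₀Equiv.symm i))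
  constructor
  · intro h i
    ext q v
    have := congrArg (fun φ : (SSet.Subcomplex.toSSet (SSet.boundary 1) ⊗ Δ[1] ⟶ Y) => φ.app q
      ((⟨SSet.stdSimplex.const 1 i q, const_mem_boundary i q⟩ :
        (SSet.Subcomplex.toSSet (SSet.boundary 1)).obj q), (v : (Δ[1] : SSet.{u}).obj q))) h
    exact this.trans (key i q)
  · intro h
    ext q ⟨⟨u, hu⟩, v⟩
    obtain ⟨i, rfl⟩ := eq_const_of_mem_boundary hu
    have := congrArg (fun φ => φ.app q v) (h i)
    exact this.trans (key i q).symm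

/-- The map `Δ[1] × Δ[1] ⟶ Δ[2]` sending `(0, t)` to `0` and `(1, t)` to `1 + t`. -/
def squareToTriangle : (Δ[1] : SSet.{u}) ⊗ Δ[1] ⟶ Δ[2] where
  app q := ↾fun p : (Δ[1] : SSet.{u}).obj q × (Δ[1] : SSet.{u}).obj q =>
    SSet.stdSimplex.objMk (n := ⦋2⦌)
      { toFun i := if SSet.stdSimplex.asOrderHom p.1 i = 0 then (0 : Fin 3) else
          (SSet.stdSimplex.asOrderHom p.2 i).succ
        monotone' := by
          intro i j hij
          have h1 := (SSet.stdSimplex.asOrderHom p.1).monotone hij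
          have h2 := (SSet.stdSimplex.asOrderHom p.2).monotone hij
          dsimp only
          split_ifs with h3 h4
          · exact le_rfl
          · exact Fin.zero_le _
          · exact absurd (le_antisymm (h1.trans (by rename_i h4; exact h4.le)) (Fin.zero_le _)) h3
          · exact Fin.succ_le_succ_iff.2 h2 }
  naturality _ _ _ := rfl

lemma ι₀_squareToTriangle : SSet.ι₀ ≫ squareToTriangle.{u} = SSet.stdSimplex.δ 2 := by
  apply SSet.yonedaEquiv.injective
  ext i
  fin_cases i <;> rfl
lemma ι₁_squareToTriangle : SSet.ι₁ ≫ squareToTriangle.{u} = SSet.stdSimplex.δ 1 := by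
  apply SSet.yonedaEquiv.injective
  ext i
  fin_cases i <;> rfl
lemma side_zero_squareToTriangle : side 0 ≫ squareToTriangle.{u} =
    SSet.const (SSet.stdSimplex.obj₀Equiv.symm 0) := by
  apply SSet.yonedaEquiv.injective
  ext i
  fin_cases i <;> rfl
lemma side_one_squareToTriangle : side 1 ≫ squareToTriangle.{u} = SSet.stdSimplex.δ 0 := by
  apply SSet.yonedaEquiv.injective
  ext i
  fin_cases i <;> rfl


lemma yapp {n : ℕ} (x : Y _⦋n⦌) {q : SimplexCategoryᵒᵖ} (u : (Δ[n] : SSet.{u}).obj q)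
    (f : q.unop ⟶ ⦋n⦌) (h : SSet.stdSimplex.objEquiv u = f) :
    (SSet.yonedaEquiv.symm x).app q u = Y.map f.op x := by
  subst h; rfl

lemma yapp_id {n : ℕ} (x : Y _⦋n⦌) (u : (Δ[n] : SSet.{u}) _⦋n⦌)
    (h : SSet.stdSimplex.objEquiv u = 𝟙 _) : (SSet.yonedaEquiv.symm x).app _ u = x := by
  refine (yapp x u _ h).trans ?_
  exact congrArg (fun f => f x) (Y.map_id (op ⦋n⦌))

lemma edge_app_zero {x y : Y _⦋0⦌} (e : SSet.Edge x y) :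
    (SSet.yonedaEquiv.symm e.edge).app _ (SSet.stdSimplex.obj₀Equiv.symm 0) = x :=
  (yapp e.edge _ (SimplexCategory.δ 1) (by ext i; fin_cases i; rfl)).trans e.src_eq

lemma edge_app_one {x y : Y _⦋0⦌} (e : SSet.Edge x y) :
    (SSet.yonedaEquiv.symm e.edge).app _ (SSet.stdSimplex.obj₀Equiv.symm 1) = y :=
  (yapp e.edge _ (SimplexCategory.δ 0) (by ext i; fin_cases i; rfl)).trans e.tgt_eq

lemma yonedaEquiv_symm_σ (y : Y _⦋0⦌) :
    SSet.yonedaEquiv.symm (Y.σ 0 y) = (SSet.const y : Δ[1] ⟶ Y) := by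
  rw [← SSet.stdSimplex.σ_comp_yonedaEquiv_symm, SSet.yonedaEquiv_symm_zero]
  rfl

lemma const_app_one (y : Y _⦋0⦌) (v : (Δ[1] : SSet.{u}) _⦋1⦌) :
    (SSet.const y : Δ[1] ⟶ Y).app (op ⦋1⦌) v = Y.σ 0 y :=
  congrArg (fun f : ⦋1⦌ ⟶ ⦋0⦌ => Y.map f.op y) (Subsingleton.elim _ _)

/-- A simplex of the square. -/
def sqpt {q : SimplexCategoryᵒᵖ} (a b : (Δ[1] : SSet.{u}).obj q) :
    (Δ[1] ⊗ Δ[1] : SSet.{u}).obj q := (a, b)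

variable [SSet.KanComplex Y]

/-- The equality of morphisms in the fundamental groupoid is the homotopy relation
relative to the boundary. -/
lemma edgeClass_eq_iff_pathHomotopic {x y : Y _⦋0⦌} (e e' : SSet.Edge x y) :
    edgeClass e = edgeClass e' ↔
      PathHomotopic (SSet.yonedaEquiv.symm e.edge) (SSet.yonedaEquiv.symm e'.edge) := by
  constructor
  · intro h
    obtain ⟨s⟩ := (edgeClass_eq_iff e e').1 h
    refine ⟨squareToTriangle ≫ SSet.yonedaEquiv.symm s.simplex, ?_, ?_, ?_⟩
    · rw [← Category.assoc, ι₀_squareToTriangle, SSet.stdSimplex.δ_comp_yonedaEquiv_symm, s.d₂]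
    · rw [← Category.assoc, ι₁_squareToTriangle, SSet.stdSimplex.δ_comp_yonedaEquiv_symm, s.d₁]
    · rw [rel_iff]
      intro i
      fin_cases i
      · change side 0 ≫ _ = SSet.const _
        rw [← Category.assoc, side_zero_squareToTriangle, SSet.const_comp]
        congr 1
        refine Eq.trans ?_ (edge_app_zero e).symm
        refine (yapp s.simplex _ (SimplexCategory.δ 1 ≫ SimplexCategory.δ 2)
          (by ext i; fin_cases i; rfl)).trans ?_
        rw [op_comp, Functor.map_comp]
        exact (congrArg (Y.δ 1) s.d₂).trans e.src_eq
      · change side 1 ≫ _ = SSet.const _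
        rw [← Category.assoc, side_one_squareToTriangle, SSet.stdSimplex.δ_comp_yonedaEquiv_symm,
          s.d₀]
        refine (yonedaEquiv_symm_σ y).trans ?_
        congr 1
        exact (edge_app_one e).symm
  · rintro ⟨F, h₀, h₁, hr⟩
    rw [rel_iff] at hr
    have hδ : ∀ {n : ℕ} (i : Fin (n + 2)) (u v : (Δ[1] : SSet.{u}) _⦋n + 1⦌),
        Y.δ i (F.app (op ⦋n + 1⦌) (sqpt (u) (v))) = F.app (op ⦋n⦌) (sqpt (Δ[1].δ i u) (Δ[1].δ i v)) :=
      fun i u v => (NatTrans.naturality_apply F (SimplexCategory.δ i).op (sqpt u v)).symm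
    have hb : ∀ v : (Δ[1] : SSet.{u}) _⦋1⦌, F.app (op ⦋1⦌) (sqpt (SSet.stdSimplex.const 1 0 _) (v)) =
        Y.σ 0 x := fun v => (congrArg (fun φ => φ.app (op ⦋1⦌) v) (hr 0)).trans
          ((const_app_one _ v).trans (congrArg (Y.σ 0) (edge_app_zero e)))
    have hb' : ∀ v : (Δ[1] : SSet.{u}) _⦋1⦌, F.app (op ⦋1⦌) (sqpt (SSet.stdSimplex.const 1 1 _) (v)) =
        Y.σ 0 y := fun v => (congrArg (fun φ => φ.app (op ⦋1⦌) v) (hr 1)).trans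
          ((const_app_one _ v).trans (congrArg (Y.σ 0) (edge_app_one e)))
    have ht : F.app (op ⦋1⦌) (sqpt (SSet.stdSimplex.edge 1 0 1 (by decide)) (SSet.stdSimplex.const 1 0 _)) =
        e.edge := (congrArg (fun φ => φ.app (op ⦋1⦌)
          (SSet.stdSimplex.edge 1 0 1 (by decide))) h₀).trans
            (yapp_id _ (SSet.stdSimplex.edge 1 0 1 (by decide)) (by ext i; fin_cases i <;> rfl))
    have ht' : F.app (op ⦋1⦌) (sqpt (SSet.stdSimplex.edge 1 0 1 (by decide)) (SSet.stdSimplex.const 1 1 _)) = e'.edge := (congrArg (fun φ => φ.app (op ⦋1⦌)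
          (SSet.stdSimplex.edge 1 0 1 (by decide))) h₁).trans
            (yapp_id _ (SSet.stdSimplex.edge 1 0 1 (by decide)) (by ext i; fin_cases i <;> rfl))
    have hsq : ∀ {n : ℕ} {a b c d : (Δ[1] : SSet.{u}) _⦋n⦌}, a = c → b = d →
        F.app (op ⦋n⦌) (sqpt (a) (b)) = F.app (op ⦋n⦌) (sqpt (c) (d)) := by rintro _ _ _ _ _ rfl rfl; rfl
    have t : ∀ {a b : (Δ[1] : SSet.{u}) _⦋1⦌}, (∀ i : Fin 2, a i = b i) → a = b :=
      fun h => SSet.stdSimplex.ext _ _ h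
    obtain ⟨d, hd⟩ : ∃ d : SSet.Edge x y, d.edge = F.app (op ⦋1⦌) (sqpt (SSet.stdSimplex.edge 1 0 1 (by decide)) (SSet.stdSimplex.edge 1 0 1 (by decide))) := by
      refine ⟨SSet.Edge.mk (F.app (op ⦋1⦌) (sqpt (SSet.stdSimplex.edge 1 0 1 (by decide)) (SSet.stdSimplex.edge 1 0 1 (by decide)))) 
          ?_ ?_, rfl⟩
      · refine Eq.trans ?_ e.src_eq
        rw [← ht, hδ, hδ]
        refine hsq rfl ?_
        ext i; fin_cases i; rfl
      · refine Eq.trans ?_ e'.tgt_eq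
        rw [← ht', hδ, hδ]
        refine hsq rfl ?_
        ext i; fin_cases i; rfl
    have t₁ : SSet.Edge.CompStruct e (SSet.Edge.id y) d := SSet.Edge.CompStruct.mk
      (F.app (op ⦋2⦌) (sqpt (SSet.stdSimplex.triangle 0 1 1 (by decide) (by decide)) (SSet.stdSimplex.triangle 0 0 1 (by decide) (by decide))))
      (by rw [hδ, ← ht]; refine hsq ?_ ?_ <;> (ext i; fin_cases i <;> rfl))
      (by
        rw [hδ]; refine Eq.trans ?_ (hb' (SSet.stdSimplex.edge 1 0 1 (by decide)))
        refine hsq ?_ ?_ <;> (ext i; fin_cases i <;> rfl))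
      (by rw [hδ, hd]; refine hsq ?_ ?_ <;> (ext i; fin_cases i <;> rfl))
    have t₂ : SSet.Edge.CompStruct (SSet.Edge.id x) e' d := SSet.Edge.CompStruct.mk
      (F.app (op ⦋2⦌) (sqpt (SSet.stdSimplex.triangle 0 0 1 (by decide) (by decide)) (SSet.stdSimplex.triangle 0 1 1 (by decide) (by decide))))
      (by
        rw [hδ]; refine Eq.trans ?_ (hb (SSet.stdSimplex.edge 1 0 1 (by decide)))
        refine hsq ?_ ?_ <;> (ext i; fin_cases i <;> rfl))
      (by rw [hδ, ← ht']; refine hsq ?_ ?_ <;> (ext i; fin_cases i <;> rfl))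
      (by rw [hδ, hd]; refine hsq ?_ ?_ <;> (ext i; fin_cases i <;> rfl))
    have e₁ := (edgeClass_comp_iff _ _ _).2 ⟨t₁⟩
    have e₂ := (edgeClass_comp_iff _ _ _).2 ⟨t₂⟩
    exact ((Category.comp_id _).symm.trans e₁).trans (e₂.symm.trans (Category.id_comp _))

end Homotopy

lemma smap_id (A : SSet.{u}) {q : SimplexCategoryᵒᵖ} (a : A.obj q) : A.map (𝟙 q) a = a :=
  congrArg (fun f => f a) (A.map_id q)

lemma smap_comp (A : SSet.{u}) {q r s : SimplexCategoryᵒᵖ} (f : q ⟶ r) (g : r ⟶ s)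
    (a : A.obj q) : A.map (f ≫ g) a = A.map g (A.map f a) :=
  congrArg (fun f => f a) (A.map_comp f g)

lemma sset_hom_ext {A B : SSet.{u}} {f g : A ⟶ B} (h : ∀ q (a : A.obj q), f.app q a = g.app q a) :
    f = g :=
  SSet.hom_ext fun q => ConcreteCategory.hom_ext _ _ (h q)

lemma type_hom_ext {S T : Type u} {f g : S ⟶ T} (h : ∀ x, f x = g x) : f = g :=
  ConcreteCategory.hom_ext _ _ h

section Equivariant

/-- The category of canonical orbits of `G`: the objects are the cosets `G/H`, `H` a subgroup. -/
structure OrbitCat (G : Type u) [Group G] : Type u where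
  /-- the subgroup `H` -/
  subgroup : Subgroup G

variable {G : Type u} [Group G]

/-- The `G`-set `G/H`. -/
abbrev OrbitCat.coset (H : OrbitCat G) : Type u := G ⧸ H.subgroup

/-- The base point `eH` of `G/H`. -/
abbrev OrbitCat.base (H : OrbitCat G) : H.coset := QuotientGroup.mk 1

/-- The morphisms of the orbit category are the `G`-maps `G/H → G/K`. -/
instance : Category (OrbitCat G) where
  Hom H K := H.coset →[G] K.coset
  id H := MulActionHom.id G
  comp f g := MulActionHom.comp g f

/-- The underlying map of a morphism of the orbit category. -/
def OrbitCat.fn {H K : OrbitCat G} (g : H ⟶ K) : H.coset → K.coset :=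
  (show H.coset →[G] K.coset from g)

lemma OrbitCat.fn_smul {H K : OrbitCat G} (g : H ⟶ K) (a : G) (c : H.coset) :
    OrbitCat.fn g (a • c) = a • OrbitCat.fn g c :=
  map_smul (show H.coset →[G] K.coset from g) a c

/-- The `G`-simplicial set `G/H × A`, with `G` acting by left translation on the first factor
and trivially on the second one. -/
def orbitProd (H : OrbitCat G) (A : SSet.{u}) : Action SSet.{u} G where
  V :=
    { obj q := H.coset × A.obj q
      map f := ↾fun p => (p.1, A.map f p.2)
      map_id q := type_hom_ext fun p => Prod.ext rfl (smap_id A p.2)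
      map_comp f g := type_hom_ext fun p => Prod.ext rfl (smap_comp A f g p.2) }
  ρ :=
    { toFun g := { app q := ↾fun p => (g • p.1, p.2), naturality _ _ _ := rfl }
      map_one' := sset_hom_ext fun q p => Prod.ext (one_smul G p.1) rfl
      map_mul' g h := sset_hom_ext fun q p => Prod.ext (mul_smul g h p.1) rfl }

/-- The simplex `(c, a)` of `G/H × A`. -/
def orbitPt {H : OrbitCat G} {A : SSet.{u}} {q : SimplexCategoryᵒᵖ} (c : H.coset) (a : A.obj q) :
    (orbitProd H A).V.obj q := (c, a)

/-- The `G`-simplicial map `ĝ × f : G/H × A ⟶ G/K × B`. -/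
def orbitMap {H K : OrbitCat G} {A B : SSet.{u}} (g : H ⟶ K) (f : A ⟶ B) :
    orbitProd H A ⟶ orbitProd K B where
  hom :=
    { app q := ↾fun p => (OrbitCat.fn g p.1, f.app q p.2)
      naturality q r α := by
        refine type_hom_ext fun p => ?_
        obtain ⟨c, (a : A.obj q)⟩ := p
        exact congrArg (Prod.mk _) (NatTrans.naturality_apply f α a) }
  comm a := sset_hom_ext fun q p => Prod.ext (OrbitCat.fn_smul g a p.1) rfl

lemma orbitMap_comp {H K L : OrbitCat G} {A B C : SSet.{u}} (g : H ⟶ K) (g' : K ⟶ L)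
    (f : A ⟶ B) (f' : B ⟶ C) :
    orbitMap (g ≫ g') (f ≫ f') = orbitMap g f ≫ orbitMap g' f' := rfl

lemma orbitMap_id (H : OrbitCat G) (A : SSet.{u}) : orbitMap (𝟙 H) (𝟙 A) = 𝟙 _ := rfl

/-- The action of `G` on the `q`-simplices of a `G`-simplicial set. -/
def act {X : Action SSet.{u} G} {q : SimplexCategoryᵒᵖ} (g : G) (x : X.V.obj q) : X.V.obj q :=
  NatTrans.app (show X.V ⟶ X.V from X.ρ g) q x

variable {X : Action SSet.{u} G}

lemma act_one {q : SimplexCategoryᵒᵖ} (x : X.V.obj q) : act (X := X) 1 x = x :=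
  congrArg (fun φ : X.V ⟶ X.V => φ.app q x) X.ρ.map_one

lemma act_mul {q : SimplexCategoryᵒᵖ} (g h : G) (x : X.V.obj q) :
    act (X := X) (g * h) x = act (X := X) g (act (X := X) h x) :=
  congrArg (fun φ : X.V ⟶ X.V => φ.app q x) (X.ρ.map_mul g h)

lemma act_map {q r : SimplexCategoryᵒᵖ} (f : q ⟶ r) (g : G) (x : X.V.obj q) :
    act (X := X) g (X.V.map f x) = X.V.map f (act (X := X) g x) :=
  NatTrans.naturality_apply (show X.V ⟶ X.V from X.ρ g) f x

lemma hom_act {X Y : Action SSet.{u} G} (σ : X ⟶ Y) {q : SimplexCategoryᵒᵖ} (g : G)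
    (x : X.V.obj q) : σ.hom.app q (act (X := X) g x) = act (X := Y) g (σ.hom.app q x) :=
  congrArg (fun φ : X.V ⟶ Y.V => φ.app q x) (σ.comm g)

/-- The fixed point simplicial set `X^H`. -/
def fixed (X : Action SSet.{u} G) (H : OrbitCat G) : X.V.Subcomplex where
  obj q := {x | ∀ h ∈ H.subgroup, act (X := X) h x = x}
  map f x hx h hh := (act_map f h x).trans (congrArg _ (hx h hh))

/-- The translate `gx` of a simplex `x` of `X^K` by the coset `gK`. -/
def cosetAct {K : OrbitCat G} {q : SimplexCategoryᵒᵖ} (x : (fixed X K : SSet.{u}).obj q)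
    (c : K.coset) : X.V.obj q :=
  Quotient.liftOn' c (fun g => act (X := X) g x.1) (by
    intro a b hab
    have := x.2 _ (QuotientGroup.leftRel_apply.1 hab)
    conv_lhs => rw [← this]
    rw [← act_mul, mul_inv_cancel_left])

lemma cosetAct_smul {K : OrbitCat G} {q : SimplexCategoryᵒᵖ} (x : (fixed X K : SSet.{u}).obj q)
    (g : G) (c : K.coset) : cosetAct x (g • c) = act (X := X) g (cosetAct x c) := by
  induction c using QuotientGroup.induction_on with
  | H a => exact act_mul g a x.1

lemma cosetAct_map {K : OrbitCat G} {q r : SimplexCategoryᵒᵖ} (f : q ⟶ r)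
    (x : (fixed X K : SSet.{u}).obj q) (c : K.coset) :
    cosetAct ((fixed X K : SSet.{u}).map f x) c = X.V.map f (cosetAct x c) := by
  induction c using QuotientGroup.induction_on with
  | H a => exact act_map f a x.1

lemma cosetAct_base {K : OrbitCat G} {q : SimplexCategoryᵒᵖ} (x : (fixed X K : SSet.{u}).obj q) :
    cosetAct x K.base = x.1 := act_one x.1

lemma smul_base (H : OrbitCat G) (g : G) : g • H.base = (QuotientGroup.mk g : H.coset) :=
  congrArg QuotientGroup.mk (mul_one g)

lemma smul_base_of_mem (H : OrbitCat G) {h : G} (hh : h ∈ H.subgroup) : h • H.base = H.base := by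
  rw [smul_base]
  exact QuotientGroup.eq.2 (by simpa using hh)

/-- The left translation `X^K ⟶ X^H` induced by a `G`-map `ĝ : G/H → G/K`,
`x ↦ gx` if `ĝ(eH) = gK`. -/
def translate (X : Action SSet.{u} G) {H K : OrbitCat G} (g : H ⟶ K) :
    (fixed X K : SSet.{u}) ⟶ (fixed X H : SSet.{u}) where
  app q := ↾fun x => ⟨cosetAct x (OrbitCat.fn g H.base), fun h hh => by
    rw [← cosetAct_smul, ← OrbitCat.fn_smul, smul_base_of_mem H hh]⟩
  naturality q r f := ConcreteCategory.hom_ext _ _ fun x => Subtype.ext (cosetAct_map f x _)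

lemma translate_val {H K : OrbitCat G} (g : H ⟶ K) {q : SimplexCategoryᵒᵖ}
    (x : (fixed X K : SSet.{u}).obj q) :
    ((translate X g).app q x).1 = cosetAct x (OrbitCat.fn g H.base) := rfl

lemma cosetAct_translate {H K : OrbitCat G} (g : H ⟶ K) {q : SimplexCategoryᵒᵖ}
    (x : (fixed X K : SSet.{u}).obj q) (c : H.coset) :
    cosetAct ((translate X g).app q x) c = cosetAct x (OrbitCat.fn g c) := by
  induction c using QuotientGroup.induction_on with
  | H a =>
    rw [← smul_base, cosetAct_smul, cosetAct_base, translate_val, OrbitCat.fn_smul, cosetAct_smul]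

/-- The `O_G`-simplicial set `G/H ↦ X^H`. -/
def fixedFunctor (X : Action SSet.{u} G) : (OrbitCat G)ᵒᵖ ⥤ SSet.{u} where
  obj H := fixed X H.unop
  map g := translate X g.unop
  map_id H := sset_hom_ext fun q x => Subtype.ext (cosetAct_base x)
  map_comp g g' := sset_hom_ext fun q x => Subtype.ext
    (cosetAct_translate g.unop x (OrbitCat.fn g'.unop (OrbitCat.base _))).symm

/-- Equivariant maps `G/H × A ⟶ X` correspond to maps `A ⟶ X^H`, by restriction to `eH`. -/
def homEquiv {X : Action SSet.{u} G} {H : OrbitCat G} {A : SSet.{u}} :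
    (orbitProd H A ⟶ X) ≃ (A ⟶ (fixed X H : SSet.{u})) where
  toFun σ :=
    { app q := ↾fun a => ⟨σ.hom.app q (orbitPt H.base a), fun h hh =>
        (hom_act σ h _).symm.trans (congrArg (fun c => σ.hom.app q (orbitPt c a))
          (smul_base_of_mem H hh))⟩
      naturality q r f := by
        refine type_hom_ext fun (a : A.obj q) => Subtype.ext ?_
        exact NatTrans.naturality_apply σ.hom f (orbitPt (q := q) (A := A) H.base a) }
  invFun f :=
    { hom :=
        { app q := ↾fun p => cosetAct (f.app q p.2) p.1
          naturality q r α := type_hom_ext fun (p : H.coset × A.obj q) =>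
            (congrArg (fun x => cosetAct x p.1) (NatTrans.naturality_apply f α p.2)).trans
              (cosetAct_map α (f.app q p.2) p.1) }
      comm g := sset_hom_ext fun q p => cosetAct_smul (f.app q p.2) g p.1 }
  left_inv σ := by
    apply Action.hom_ext
    refine sset_hom_ext fun q p => ?_
    obtain ⟨c, a⟩ := p
    induction c using QuotientGroup.induction_on with
    | H g =>
      exact (hom_act σ g _).symm.trans (congrArg (fun c => σ.hom.app q (orbitPt c a))
          (smul_base H g))
  right_inv f := sset_hom_ext fun q a => Subtype.ext (cosetAct_base _)

lemma homEquiv_orbitMap {H K : OrbitCat G} {A B : SSet.{u}} (g : H ⟶ K) (f : A ⟶ B)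
    (σ : orbitProd K B ⟶ X) :
    homEquiv (orbitMap g f ≫ σ) = f ≫ homEquiv σ ≫ translate X g := by
  obtain ⟨τ, rfl⟩ := homEquiv.symm.surjective σ
  rw [Equiv.apply_symm_apply]
  refine sset_hom_ext fun q a => Subtype.ext rfl

lemma homEquiv_orbitMap_id {H : OrbitCat G} {A B : SSet.{u}} (f : A ⟶ B)
    (σ : orbitProd H B ⟶ X) :
    homEquiv (orbitMap (𝟙 H) f ≫ σ) = f ≫ homEquiv σ := rfl

end Equivariant

section FundGroupoid
open CartesianMonoidalCategory

variable {G : Type u} [Group G]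

/-- A `G`-Kan complex: all the fixed point simplicial sets are Kan complexes. -/
class IsGKan (X : Action SSet.{u} G) : Prop where
  kan : ∀ H : OrbitCat G, SSet.KanComplex (fixed X H : SSet.{u})

instance (X : Action SSet.{u} G) [IsGKan X] (H : OrbitCat G) :
    SSet.KanComplex (fixed X H : SSet.{u}) := IsGKan.kan H

/-- The equivariant `n`-simplices of type `H` in `X`: the `G`-maps `G/H × Δ[n] ⟶ X`. -/
abbrev EquivSimplex (X : Action SSet.{u} G) (H : OrbitCat G) (n : ℕ) : Type u :=
  orbitProd H Δ[n] ⟶ X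

/-- The bijection `σ ↦ σ' = σ(eH, Δ_n)` of the equivariant `n`-simplices of type `H` with the
`n`-simplices of `X^H`. -/
def simplexEquiv {X : Action SSet.{u} G} {H : OrbitCat G} {n : ℕ} :
    EquivSimplex X H n ≃ (fixed X H : SSet.{u}) _⦋n⦌ :=
  homEquiv.trans SSet.yonedaEquiv

variable {X : Action SSet.{u} G}

lemma simplexEquiv_val {H : OrbitCat G} {n : ℕ} (σ : EquivSimplex X H n) :
    (simplexEquiv σ).1 = σ.hom.app (op ⦋n⦌)
      (orbitPt H.base (SSet.stdSimplex.objEquiv.symm (𝟙 ⦋n⦌))) := rfl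

lemma translate_comp {H K L : OrbitCat G} (g : H ⟶ K) (g' : K ⟶ L) {q : SimplexCategoryᵒᵖ}
    (x : (fixed X L : SSet.{u}).obj q) :
    (translate X (g ≫ g')).app q x = (translate X g).app q ((translate X g').app q x) :=
  congrArg (fun φ => φ.app q x) ((fixedFunctor X).map_comp g'.op g.op)

lemma translate_id {H : OrbitCat G} {q : SimplexCategoryᵒᵖ}
    (x : (fixed X H : SSet.{u}).obj q) :
    (translate X (𝟙 H)).app q x = x :=
  congrArg (fun φ => φ.app q x) ((fixedFunctor X).map_id (op H))

lemma translate_map {H K : OrbitCat G} (g : H ⟶ K) {q r : SimplexCategoryᵒᵖ} (f : q ⟶ r)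
    (x : (fixed X K : SSet.{u}).obj q) :
    (translate X g).app r ((fixed X K : SSet.{u}).map f x) =
      (fixed X H : SSet.{u}).map f ((translate X g).app q x) :=
  NatTrans.naturality_apply (translate X g) f x

/-- The `θ`-face `σ ∘ (id × θ)` of an equivariant simplex. -/
def EquivSimplex.face {H : OrbitCat G} {m n : ℕ} (σ : EquivSimplex X H n) (θ : ⦋m⦌ ⟶ ⦋n⦌) :
    EquivSimplex X H m :=
  orbitMap (𝟙 H) (SSet.stdSimplex.map θ) ≫ σ

/-- The equivariant simplex `τ ∘ (ĝ × id)`. -/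
def EquivSimplex.pull {H K : OrbitCat G} {n : ℕ} (τ : EquivSimplex X K n) (g : H ⟶ K) :
    EquivSimplex X H n :=
  orbitMap g (𝟙 _) ≫ τ

lemma simplexEquiv_face {H : OrbitCat G} {m n : ℕ} (σ : EquivSimplex X H n) (θ : ⦋m⦌ ⟶ ⦋n⦌) :
    simplexEquiv (σ.face θ) = (fixed X H : SSet.{u}).map θ.op (simplexEquiv σ) := by
  change SSet.yonedaEquiv (homEquiv _) = _
  rw [EquivSimplex.face, homEquiv_orbitMap_id]
  exact NatTrans.naturality_apply (homEquiv σ) θ.op (SSet.stdSimplex.objEquiv.symm (𝟙 ⦋n⦌))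

lemma simplexEquiv_pull {H K : OrbitCat G} {n : ℕ} (τ : EquivSimplex X K n) (g : H ⟶ K) :
    simplexEquiv (τ.pull g) = (translate X g).app _ (simplexEquiv τ) := by
  change SSet.yonedaEquiv (homEquiv _) = _
  rw [EquivSimplex.pull, homEquiv_orbitMap]
  rfl

lemma EquivSimplex.face_face {H : OrbitCat G} {m n k : ℕ} (σ : EquivSimplex X H n)
    (θ : ⦋m⦌ ⟶ ⦋n⦌) (θ' : ⦋k⦌ ⟶ ⦋m⦌) : (σ.face θ).face θ' = σ.face (θ' ≫ θ) := by
  apply simplexEquiv.injective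
  simp only [simplexEquiv_face]
  exact (smap_comp _ _ _ _).symm

lemma EquivSimplex.face_id {H : OrbitCat G} {n : ℕ} (σ : EquivSimplex X H n) :
    σ.face (𝟙 _) = σ := by
  apply simplexEquiv.injective
  simp only [simplexEquiv_face]
  exact smap_id _ _

lemma EquivSimplex.pull_face {H K : OrbitCat G} {m n : ℕ} (τ : EquivSimplex X K n) (g : H ⟶ K)
    (θ : ⦋m⦌ ⟶ ⦋n⦌) : (τ.pull g).face θ = (τ.face θ).pull g := by
  apply simplexEquiv.injective
  simp only [simplexEquiv_face, simplexEquiv_pull]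
  exact (translate_map _ _ _).symm

lemma EquivSimplex.pull_pull {H K L : OrbitCat G} {n : ℕ} (τ : EquivSimplex X L n) (g : H ⟶ K)
    (g' : K ⟶ L) : (τ.pull g').pull g = τ.pull (g ≫ g') := by
  apply simplexEquiv.injective
  simp only [simplexEquiv_pull]
  exact (translate_comp _ _ _).symm

lemma EquivSimplex.pull_id {H : OrbitCat G} {n : ℕ} (σ : EquivSimplex X H n) :
    σ.pull (𝟙 _) = σ := by
  apply simplexEquiv.injective
  simp only [simplexEquiv_pull]
  exact translate_id _

variable (X) in
/-- The objects of the fundamental groupoid `ΠX`: the equivariant `0`-simplices `x_H`. -/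
structure FundGroupoid : Type u where
  /-- the type `G/H` -/
  orbit : OrbitCat G
  /-- the `G`-map `G/H × Δ[0] ⟶ X` -/
  pt : EquivSimplex X orbit 0

namespace FundGroupoid

/-- The pairs `(ĝ, φ)` representing the morphisms `x_H ⟶ y_K` of `ΠX`. -/
@[ext]
structure Path (x y : FundGroupoid X) : Type u where
  /-- the `G`-map `ĝ : G/H ⟶ G/K` -/
  orb : x.orbit ⟶ y.orbit
  /-- the equivariant `1`-simplex `φ` -/
  path : EquivSimplex X x.orbit 1
  src : path.face (SimplexCategory.δ 1) = x.pt
  tgt : path.face (SimplexCategory.δ 0) = y.pt.pull orb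

variable {x y z w : FundGroupoid X}

/-- `(ĝ₁, φ₁) ∼ (ĝ₂, φ₂)` if `ĝ₁ = ĝ₂` and there is a `G`-homotopy
`Φ : G/H × Δ[1] × Δ[1] ⟶ X` from `φ₁` to `φ₂` relative to `G/H × ∂Δ[1]`; the second factor `Δ[1]`
is the homotopy parameter. -/
def Homotopic (p q : Path x y) : Prop :=
  p.orb = q.orb ∧ ∃ Φ : orbitProd x.orbit (Δ[1] ⊗ Δ[1]) ⟶ X,
    orbitMap (𝟙 _) SSet.ι₀ ≫ Φ = p.path ∧ orbitMap (𝟙 _) SSet.ι₁ ≫ Φ = q.path ∧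
    orbitMap (𝟙 _) ((SSet.boundary 1).ι ▷ Δ[1]) ≫ Φ =
      orbitMap (𝟙 _) (fst _ _ ≫ (SSet.boundary 1).ι) ≫ p.path

/-- `r` represents the composite of `p = (ĝ₁, φ₁)` and `q = (ĝ₂, φ₂)`: there is an equivariant
`2`-simplex `ξ` with faces `φ₁`, `φ₂ ∘ (ĝ₁ × id)` and `r`. -/
def IsComp (p : Path x y) (q : Path y z) (r : Path x z) : Prop :=
  r.orb = p.orb ≫ q.orb ∧ ∃ ξ : EquivSimplex X x.orbit 2,
    ξ.face (SimplexCategory.δ 0) = q.path.pull p.orb ∧ ξ.face (SimplexCategory.δ 2) = p.path ∧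
      ξ.face (SimplexCategory.δ 1) = r.path

section aux

/-- The `0`-simplex of `X^H` of an object, translated by `ĝ`. -/
def vtx {H : OrbitCat G} (g : H ⟶ x.orbit) : (fixed X H : SSet.{u}) _⦋0⦌ :=
  simplexEquiv (x.pt.pull g)

/-- The `1`-simplex of `X^H` given by a path, translated by `ĝ`. -/
def tedge {H : OrbitCat G} (f : H ⟶ x.orbit) (p : Path x y) (g : H ⟶ y.orbit)
    (h : f ≫ p.orb = g) : SSet.Edge (vtx f) (vtx g) :=
  SSet.Edge.mk (simplexEquiv (p.path.pull f))
    ((simplexEquiv_face _ (SimplexCategory.δ 1)).symm.trans (by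
      rw [EquivSimplex.pull_face, p.src]; rfl))
    ((simplexEquiv_face _ (SimplexCategory.δ 0)).symm.trans (by
      rw [EquivSimplex.pull_face, p.tgt, EquivSimplex.pull_pull, h]; rfl))

lemma translate_tedge {H K : OrbitCat G} (k : H ⟶ K) (f : K ⟶ x.orbit) (p : Path x y)
    (g : K ⟶ y.orbit) (h : f ≫ p.orb = g) (f' : H ⟶ x.orbit) (g' : H ⟶ y.orbit)
    (hf : k ≫ f = f') (hg : k ≫ g = g') :
    (translate X k).app _ (tedge f p g h).edge =
      (tedge f' p g' (by rw [← hf, ← hg, ← h, Category.assoc])).edge := by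
  subst hf
  change (translate X k).app _ (simplexEquiv (p.path.pull f)) = simplexEquiv (p.path.pull (k ≫ f))
  rw [← simplexEquiv_pull, EquivSimplex.pull_pull]

/-- The constant path. -/
def Path.const (x : FundGroupoid X) : Path x x where
  orb := 𝟙 _
  path := x.pt.face (SimplexCategory.σ 0)
  src := (EquivSimplex.face_face _ _ _).trans
    ((congrArg x.pt.face (Subsingleton.elim _ _)).trans x.pt.face_id)
  tgt := (EquivSimplex.face_face _ _ _).trans
    (((congrArg x.pt.face (Subsingleton.elim _ _)).trans x.pt.face_id).trans x.pt.pull_id.symm)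

lemma isComp_const_left (p : Path x y) : IsComp (Path.const x) p p := by
  refine ⟨(Category.id_comp _).symm, p.path.face (SimplexCategory.σ 0), ?_, ?_, ?_⟩
  · rw [EquivSimplex.face_face]
    refine (congrArg p.path.face ?_).trans (p.path.face_id.trans p.path.pull_id.symm)
    exact SimplexCategory.δ_comp_σ_self' rfl
  · rw [EquivSimplex.face_face]
    change _ = x.pt.face _
    rw [← p.src, EquivSimplex.face_face]
    exact congrArg p.path.face (SimplexCategory.δ_comp_σ_of_gt (i := 1) (j := 0) (by decide))
  · rw [EquivSimplex.face_face]
    exact (congrArg p.path.face (SimplexCategory.δ_comp_σ_succ' rfl)).trans p.path.face_id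

lemma isComp_const_right (p : Path x y) : IsComp p (Path.const y) p := by
  refine ⟨(Category.comp_id _).symm, p.path.face (SimplexCategory.σ 1), ?_, ?_, ?_⟩
  · rw [EquivSimplex.face_face]
    change _ = (y.pt.face _).pull _
    rw [← EquivSimplex.pull_face, ← p.tgt, EquivSimplex.face_face]
    exact congrArg p.path.face (SimplexCategory.δ_comp_σ_of_le (i := 0) (j := 0) (by decide))
  · rw [EquivSimplex.face_face]
    exact (congrArg p.path.face (SimplexCategory.δ_comp_σ_succ' rfl)).trans p.path.face_id
  · rw [EquivSimplex.face_face]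
    exact (congrArg p.path.face (SimplexCategory.δ_comp_σ_self' rfl)).trans p.path.face_id

variable [IsGKan X]

/-- The class of `tedge`. -/
def tclass {H : OrbitCat G} (f : H ⟶ x.orbit) (p : Path x y) (g : H ⟶ y.orbit)
    (h : f ≫ p.orb = g) : fpt _ (vtx f) ⟶ fpt _ (vtx g) := edgeClass (tedge f p g h)

lemma homotopic_iff (p q : Path x y) : Homotopic p q ↔
    ∃ h : p.orb = q.orb, tclass (𝟙 _) p p.orb (Category.id_comp _) =
      tclass (𝟙 _) q p.orb ((Category.id_comp _).trans h.symm) := by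
  have e : ∀ {A B : SSet.{u}} (f : A ⟶ B) (ψ : orbitProd x.orbit B ⟶ X)
      (χ : orbitProd x.orbit A ⟶ X), orbitMap (𝟙 _) f ≫ ψ = χ ↔ f ≫ homEquiv ψ = homEquiv χ :=
    fun f ψ χ => by rw [← homEquiv_orbitMap_id, homEquiv.apply_eq_iff_eq]
  have e' : ∀ p : Path x y, SSet.yonedaEquiv.symm (simplexEquiv (p.path.pull (𝟙 _))) =
      homEquiv p.path := fun p => by
    rw [EquivSimplex.pull_id]; exact SSet.yonedaEquiv.symm_apply_apply (homEquiv p.path)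
  unfold Homotopic
  rw [← exists_prop]
  refine exists_congr fun h => ?_
  rw [tclass, tclass, edgeClass_eq_iff_pathHomotopic]
  change _ ↔ PathHomotopic (SSet.yonedaEquiv.symm (simplexEquiv (p.path.pull (𝟙 _))))
    (SSet.yonedaEquiv.symm (simplexEquiv (q.path.pull (𝟙 _))))
  rw [e', e']
  unfold PathHomotopic
  refine (Equiv.exists_congr_left homEquiv).trans (exists_congr fun F => ?_)
  rw [e, e, e, homEquiv_orbitMap_id, Equiv.apply_symm_apply, Category.assoc]

/-- A morphism, translated: the functoriality of `X^K ⟶ X^H` on fundamental groupoids. -/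
lemma translate_class {K H : OrbitCat G} (g : H ⟶ K) {a b c : (fixed X K : SSet.{u}) _⦋0⦌}
    {a' b' c' : (fixed X H : SSet.{u}) _⦋0⦌}
    {e : SSet.Edge a b} {e' : SSet.Edge b c} {e'' : SSet.Edge a c}
    {t : SSet.Edge a' b'} {t' : SSet.Edge b' c'} {t'' : SSet.Edge a' c'}
    (h : (translate X g).app _ e.edge = t.edge) (h' : (translate X g).app _ e'.edge = t'.edge)
    (h'' : (translate X g).app _ e''.edge = t''.edge)
    (hc : edgeClass e ≫ edgeClass e' = edgeClass e'') :
    edgeClass t ≫ edgeClass t' = edgeClass t'' := by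
  obtain ⟨s, h₂, h₀, h₁⟩ := (exists_comp_iff _ _ _).1 hc
  refine (exists_comp_iff _ _ _).2 ⟨(translate X g).app _ s, ?_, ?_, ?_⟩
  · exact (translate_map g (SimplexCategory.δ 2).op s).symm.trans
      ((congrArg ((translate X g).app _) h₂).trans h)
  · exact (translate_map g (SimplexCategory.δ 0).op s).symm.trans
      ((congrArg ((translate X g).app _) h₀).trans h')
  · exact (translate_map g (SimplexCategory.δ 1).op s).symm.trans
      ((congrArg ((translate X g).app _) h₁).trans h'')

lemma tedge_comp_iff {H : OrbitCat G} (f : H ⟶ x.orbit) (p : Path x y)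
    (g : H ⟶ y.orbit) (h : f ≫ p.orb = g) (q : Path y z) (k : H ⟶ z.orbit)
    (h' : g ≫ q.orb = k) (r : Path x z) (h'' : f ≫ r.orb = k) :
    tclass f p g h ≫ tclass g q k h' = tclass f r k h'' ↔
      ∃ ξ : EquivSimplex X H 2,
        ξ.face (SimplexCategory.δ 0) = q.path.pull g ∧
          ξ.face (SimplexCategory.δ 2) = p.path.pull f ∧
            ξ.face (SimplexCategory.δ 1) = r.path.pull f := by
  refine (exists_comp_iff _ _ _).trans ((Equiv.exists_congr_left simplexEquiv.symm).trans
    (exists_congr fun ξ => ?_))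
  simp only [Equiv.symm_symm, ← simplexEquiv.apply_eq_iff_eq (y := _ )]
  simp only [simplexEquiv_face]
  exact ⟨fun ⟨a, b, c⟩ => ⟨b, a, c⟩, fun ⟨a, b, c⟩ => ⟨b, a, c⟩⟩

lemma isComp_iff (p : Path x y) (q : Path y z) (r : Path x z) : IsComp p q r ↔
    ∃ h : r.orb = p.orb ≫ q.orb,
    tclass (𝟙 _) p p.orb (Category.id_comp _) ≫ tclass p.orb q r.orb h.symm =
      tclass (𝟙 _) r r.orb (Category.id_comp _) := by
  unfold IsComp
  rw [← exists_prop]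
  refine exists_congr fun h => ?_
  rw [tedge_comp_iff]
  simp only [EquivSimplex.pull_id]

lemma IsComp.tclass {p : Path x y} {q : Path y z} {r : Path x z} (hc : IsComp p q r)
    {H : OrbitCat G} (f : H ⟶ x.orbit) 
    (g : H ⟶ y.orbit) (h : f ≫ p.orb = g) (k : H ⟶ z.orbit)
    (h' : g ≫ q.orb = k) :
    tclass f p g h ≫ tclass g q k h' = tclass f r k (by rw [hc.1, ← h', ← h, Category.assoc]) := by
  obtain ⟨e, hc'⟩ := (isComp_iff _ _ _).1 hc
  refine translate_class f ?_ ?_ ?_ hc'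
  · exact translate_tedge _ _ _ _ _ _ _ (Category.comp_id _) h
  · exact translate_tedge _ _ _ _ _ _ _ h (by rw [e, ← h', ← h, Category.assoc])
  · exact translate_tedge _ _ _ _ _ _ _ (Category.comp_id _) (by rw [e, ← h', ← h, Category.assoc])

lemma Homotopic.tclass {p q : Path x y} (hpq : Homotopic p q) {H : OrbitCat G} (f : H ⟶ x.orbit)
    (g : H ⟶ y.orbit) (h : f ≫ p.orb = g) :
    tclass f p g h = tclass f q g (hpq.1 ▸ h) := by
  obtain ⟨h', hc⟩ := (homotopic_iff p q).1 hpq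
  rw [← Category.comp_id (FundGroupoid.tclass f p g h), ← edgeClass_id]
  refine translate_class f (e' := SSet.Edge.id _) ?_ ?_ ?_
    ((congrArg (· ≫ _) hc).trans (Category.comp_id _) |> fun a => (Category.comp_id _).trans hc)
  · exact translate_tedge _ _ _ _ _ _ _ (Category.comp_id _) h
  · refine (translate_map f (SimplexCategory.σ 0).op _).trans ?_
    congr 1
    rw [vtx, ← simplexEquiv_pull, EquivSimplex.pull_pull, h]
    rfl
  · exact translate_tedge _ _ _ _ _ _ _ (Category.comp_id _) h

lemma homotopic_iff_tclass (p q : Path x y) (h : p.orb = q.orb) {g : x.orbit ⟶ y.orbit}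
    (hp : 𝟙 _ ≫ p.orb = g) (hq : 𝟙 _ ≫ q.orb = g) : Homotopic p q ↔
    FundGroupoid.tclass (𝟙 _) p g hp = FundGroupoid.tclass (𝟙 _) q g hq := by
  obtain rfl : p.orb = g := (Category.id_comp _).symm.trans hp
  exact (homotopic_iff p q).trans ⟨fun a => a.2, fun a => ⟨h, a⟩⟩

lemma homotopic_equivalence : Equivalence (Homotopic (x := x) (y := y)) where
  refl p := (homotopic_iff p p).2 ⟨rfl, rfl⟩
  symm {p q} h := (homotopic_iff_tclass q p h.1.symm (Category.id_comp _)
    ((Category.id_comp _).trans h.1)).2 (h.tclass _ _ _).symm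
  trans {p q r} h h' := (homotopic_iff_tclass p r (h.1.trans h'.1) (Category.id_comp _) _).2
    ((h.tclass _ _ _).trans (h'.tclass _ _ _))

lemma exists_isComp (p : Path x y) (q : Path y z) : ∃ r, IsComp p q r := by
  obtain ⟨⟨e, he⟩⟩ := fill21 (tedge (𝟙 _) p p.orb (Category.id_comp _))
    (tedge p.orb q (p.orb ≫ q.orb) rfl)
  have h : simplexEquiv ((simplexEquiv (X := X) (H := x.orbit) (n := 1)).symm e.edge) = e.edge :=
    Equiv.apply_symm_apply _ _
  obtain ⟨ξ, hξ⟩ := (simplexEquiv (X := X) (H := x.orbit) (n := 2)).surjective he.simplex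
  refine ⟨⟨p.orb ≫ q.orb, simplexEquiv.symm e.edge, ?_, ?_⟩, rfl, ξ, ?_, ?_, ?_⟩
  · apply simplexEquiv.injective
    rw [simplexEquiv_face, h]
    refine e.src_eq.trans ?_
    rw [vtx, EquivSimplex.pull_id]
  · apply simplexEquiv.injective
    rw [simplexEquiv_face, h]
    exact e.tgt_eq
  · apply simplexEquiv.injective
    rw [simplexEquiv_face, hξ]
    exact he.d₀
  · apply simplexEquiv.injective
    rw [simplexEquiv_face, hξ]
    refine he.d₂.trans ?_
    change simplexEquiv _ = _
    rw [EquivSimplex.pull_id]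
  · apply simplexEquiv.injective
    rw [simplexEquiv_face, hξ]
    exact he.d₁.trans h.symm

lemma IsComp.unique {p p' : Path x y} {q q' : Path y z} {r r' : Path x z} (h : IsComp p q r)
    (h' : IsComp p' q' r') (hp : Homotopic p p') (hq : Homotopic q q') : Homotopic r r' := by
  have e : r.orb = r'.orb := by rw [h.1, h'.1, hp.1, hq.1]
  have hq' : p.orb ≫ q.orb = r.orb := h.1.symm
  have hr' : 𝟙 _ ≫ r'.orb = r.orb := (Category.id_comp _).trans e.symm
  refine (homotopic_iff_tclass r r' e (Category.id_comp _) hr').2 ?_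
  rw [← h.tclass (𝟙 _) p.orb (Category.id_comp _) r.orb hq',
    ← h'.tclass (𝟙 _) p.orb (by rw [hp.1]; exact Category.id_comp _) r.orb (by rw [← hq', hq.1]),
    hp.tclass, hq.tclass]

/-- The equivalence relation defining the morphisms of `ΠX`. -/
instance pathSetoid : Setoid (Path x y) := ⟨Homotopic, homotopic_equivalence⟩

lemma IsComp.assoc {p : Path x y} {q : Path y z} {r : Path z w} {pq : Path x z} {qr : Path y w}
    {s s' : Path x w} (h : IsComp p q pq) (h' : IsComp pq r s) (k : IsComp q r qr)
    (k' : IsComp p qr s') : Homotopic s s' := by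
  have e : s.orb = s'.orb := by rw [h'.1, h.1, k'.1, k.1, Category.assoc]
  have e₁ : pq.orb ≫ r.orb = s.orb := h'.1.symm
  have e₂ : p.orb ≫ qr.orb = s.orb := k'.1.symm.trans e.symm
  refine (homotopic_iff_tclass s s' e (Category.id_comp _) ((Category.id_comp _).trans e.symm)).2 ?_
  rw [← h'.tclass (𝟙 _) pq.orb (Category.id_comp _) s.orb e₁,
    ← h.tclass (𝟙 _) p.orb (Category.id_comp _) pq.orb h.1.symm,
    ← k'.tclass (𝟙 _) p.orb (Category.id_comp _) s.orb e₂,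
    ← k.tclass p.orb pq.orb h.1.symm s.orb e₁, Category.assoc]

end aux

variable [IsGKan X]

/-- The fundamental groupoid `ΠX`. The composite of the classes of `p` and `q` is the class of
any `r` with `IsComp p q r`. -/
noncomputable instance : Category (FundGroupoid X) where
  Hom x y := Quotient (pathSetoid (x := x) (y := y))
  id x := Quotient.mk _ (Path.const x)
  comp := Quotient.map₂ (fun p q => (exists_isComp p q).choose) fun p p' hp q q' hq =>
    (exists_isComp p q).choose_spec.unique (exists_isComp p' q').choose_spec hp hq
  id_comp := by
    rintro x y ⟨p⟩
    exact Quotient.sound ((exists_isComp _ _).choose_spec.unique (isComp_const_left p)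
      (homotopic_equivalence.refl _) (homotopic_equivalence.refl _))
  comp_id := by
    rintro x y ⟨p⟩
    exact Quotient.sound ((exists_isComp _ _).choose_spec.unique (isComp_const_right p)
      (homotopic_equivalence.refl _) (homotopic_equivalence.refl _))
  assoc := by
    rintro x y z w ⟨p⟩ ⟨q⟩ ⟨r⟩
    exact Quotient.sound (IsComp.assoc (exists_isComp _ _).choose_spec
      (exists_isComp _ _).choose_spec (exists_isComp _ _).choose_spec
      (exists_isComp _ _).choose_spec)

/-- The morphism `[ĝ, φ]` of `ΠX`. -/
def homMk {x y : FundGroupoid X} (p : Path x y) : x ⟶ y := Quotient.mk _ p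

lemma homMk_surjective {x y : FundGroupoid X} (f : x ⟶ y) : ∃ p, homMk p = f :=
  Quotient.exists_rep f

lemma homMk_eq_iff {x y : FundGroupoid X} (p q : Path x y) :
    homMk p = homMk q ↔ Homotopic p q := Quotient.eq (r := pathSetoid)

lemma homMk_const (x : FundGroupoid X) : homMk (Path.const x) = 𝟙 x := rfl

lemma homMk_comp {p : Path x y} {q : Path y z} {r : Path x z} (h : IsComp p q r) :
    homMk p ≫ homMk q = homMk r :=
  Quotient.sound ((exists_isComp _ _).choose_spec.unique h
      (homotopic_equivalence.refl _) (homotopic_equivalence.refl _))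

end FundGroupoid
end FundGroupoid

section AlternatingSums

lemma alternating_double_sum {A : Type*} [AddCommGroup A] (n : ℕ)
    (F : Fin (n + 3) → Fin (n + 2) → A)
    (h : ∀ i j : Fin (n + 2), i ≤ j → F i.castSucc j = F j.succ i) :
    ∑ i : Fin (n + 3), (-1 : ℤ) ^ (i : ℕ) • ∑ j : Fin (n + 2), (-1 : ℤ) ^ (j : ℕ) • F i j = 0 := by
  simp only [Finset.smul_sum, smul_smul]
  rw [← Finset.sum_product', Finset.univ_product_univ]
  refine Finset.sum_involution (fun p _ => if hp : p.1.val ≤ p.2.val then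
      (p.2.succ, ⟨p.1.val, by omega⟩) else
      (p.2.castSucc, ⟨p.1.val - 1, by omega⟩)) ?_ ?_ ?_ ?_
  · rintro ⟨i, j⟩ -
    dsimp only
    split_ifs with hp
    · have := h ⟨i.val, by omega⟩ j hp
      have e : (⟨i.val, by omega⟩ : Fin (n + 2)).castSucc = i := rfl
      rw [e] at this
      rw [this, ← add_smul]
      convert zero_smul ℤ _
      simp only [Fin.val_succ]
      ring
    · have := h j ⟨i.val - 1, by omega⟩ (by simp only [Fin.le_def]; omega)
      have e : (⟨i.val - 1, by omega⟩ : Fin (n + 2)).succ = i := by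
        ext; simp only [Fin.val_succ]; omega
      rw [e] at this
      rw [← this, ← add_smul]
      convert zero_smul ℤ _
      simp only [Fin.val_castSucc]
      obtain ⟨k, hk⟩ : ∃ k, i.val = k + 1 := ⟨i.val - 1, by omega⟩
      rw [hk, Nat.add_sub_cancel]
      ring
  · rintro ⟨i, j⟩ - - heq
    dsimp only at heq
    split_ifs at heq with hp
    · have := congrArg (fun p : Fin (n + 3) × Fin (n + 2) => p.1.val) heq
      simp only [Fin.val_succ] at this
      omega
    · have := congrArg (fun p : Fin (n + 3) × Fin (n + 2) => p.1.val) heq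
      simp only [Fin.val_castSucc] at this
      omega
  · simp
  · rintro ⟨i, j⟩ -
    dsimp only
    split_ifs with hp hq hq
    · simp only [Fin.val_succ] at hq; omega
    · simp
    · ext
      · simp only [Fin.val_succ]; omega
      · rfl
    · simp only [Fin.val_castSucc] at hq; omega

lemma alternating_sum_pair {A : Type*} [AddCommGroup A] (n : ℕ) (g : Fin (n + 2) → A)
    (i : Fin (n + 1)) (h₀ : ∀ j, j ≠ i.castSucc → j ≠ i.succ → g j = 0)
    (h : g i.castSucc = g i.succ) : ∑ j : Fin (n + 2), (-1 : ℤ) ^ (j : ℕ) • g j = 0 := by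
  rw [Finset.sum_eq_add (i.castSucc) (i.succ) (Fin.castSucc_lt_succ).ne
    (fun j _ hj => by rw [h₀ j hj.1 hj.2, smul_zero]) (by simp) (by simp), h, ← add_smul]
  convert zero_smul ℤ _
  simp only [Fin.val_castSucc, Fin.val_succ]
  ring

end AlternatingSums

section BredonIllmanComplex

variable {G : Type u} [Group G] {X : Action SSet.{u} G}

/-- The object `σ_H = σ ∘ (id × δ_{(1,…,n)})` of `ΠX`, i.e. the initial vertex of `σ`. -/
abbrev EquivSimplex.vertex {H : OrbitCat G} {n : ℕ} (σ : EquivSimplex X H n) : FundGroupoid X where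
  orbit := H
  pt := σ.face (SimplexCategory.const ⦋0⦌ ⦋n⦌ 0)

/-- The initial vertex `[0] ⟶ [n + 1]` is the composite of `δ_1, …, δ_{n + 1}`. -/
lemma const_zero_succ (n : ℕ) : SimplexCategory.const ⦋0⦌ ⦋n + 1⦌ 0 =
    SimplexCategory.const ⦋0⦌ ⦋n⦌ 0 ≫ SimplexCategory.δ (Fin.last (n + 1)) := by
  ext i
  rfl

/-- The initial edge `[1] ⟶ [n + 2]` is the composite of `δ_2, …, δ_{n + 2}`. -/
lemma mkOfLe_zero_one_succ (n : ℕ) :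
    SimplexCategory.mkOfLe (n := n + 2) 0 1 (Fin.zero_le _) =
      SimplexCategory.mkOfLe (n := n + 1) 0 1 (Fin.zero_le _) ≫
        SimplexCategory.δ (Fin.last (n + 2)) := by
  refine SimplexCategory.Hom.ext_one_left _ _ rfl ?_
  change (1 : Fin (n + 3)) = (Fin.last (n + 2)).succAbove (1 : Fin (n + 2))
  rw [Fin.succAbove_last]
  rfl

/-- `σ` is degenerate if the simplex `σ'` of `X^H` is. -/
def EquivSimplex.IsDegenerate {H : OrbitCat G} {n : ℕ} (σ : EquivSimplex X H n) : Prop :=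
  simplexEquiv σ ∈ (fixed X H : SSet.{u}).degenerate n

/-- For `τ ∘ (ĝ × id) = σ ∘ (id × θ)`, the representative `(ĝ, φ)` of a morphism `σ_H ⟶ τ_K`
with `φ` the edge of `σ` from `0` to `θ(0)`. -/
def vertexPath {H K : OrbitCat G} {m n : ℕ} (σ : EquivSimplex X H n) (τ : EquivSimplex X K m)
    (g : H ⟶ K) (θ : ⦋m⦌ ⟶ ⦋n⦌) (h : σ.face θ = τ.pull g) :
    FundGroupoid.Path σ.vertex τ.vertex where
  orb := g
  path := σ.face (SimplexCategory.mkOfLe 0 (θ 0) (Fin.zero_le _))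
  src := by
    rw [EquivSimplex.face_face]
    refine congrArg σ.face ?_
    ext i; fin_cases i; rfl
  tgt := by
    rw [EquivSimplex.face_face]
    change _ = EquivSimplex.pull (EquivSimplex.face _ _) _
    rw [← EquivSimplex.pull_face, ← h, EquivSimplex.face_face]
    refine congrArg σ.face ?_
    ext i; fin_cases i; rfl

lemma vertexPath_isComp {H K L : OrbitCat G} {m n k : ℕ} (σ : EquivSimplex X H n)
    (τ : EquivSimplex X K m) (ρ : EquivSimplex X L k)
    (g : H ⟶ K) (θ : ⦋m⦌ ⟶ ⦋n⦌) (h : σ.face θ = τ.pull g)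
    (g' : K ⟶ L) (θ' : ⦋k⦌ ⟶ ⦋m⦌) (h' : τ.face θ' = ρ.pull g')
    (h'' : σ.face (θ' ≫ θ) = ρ.pull (g ≫ g')) :
    FundGroupoid.IsComp (vertexPath σ τ g θ h) (vertexPath τ ρ g' θ' h')
      (vertexPath σ ρ (g ≫ g') (θ' ≫ θ) h'') := by
  have hm : θ 0 ≤ θ (θ' 0) := θ.toOrderHom.monotone (Fin.zero_le _)
  refine ⟨rfl, σ.face (SimplexCategory.mkOfLeComp 0 (θ 0) (θ (θ' 0)) (Fin.zero_le _) hm),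
    ?_, ?_, ?_⟩
  · change _ = EquivSimplex.pull (EquivSimplex.face _ _) _
    change _ = EquivSimplex.pull (EquivSimplex.face _ _) g
    rw [← EquivSimplex.pull_face, ← h, EquivSimplex.face_face, EquivSimplex.face_face]
    refine congrArg σ.face ?_
    exact SimplexCategory.Hom.ext_one_left _ _ rfl rfl
  · rw [EquivSimplex.face_face]
    refine congrArg σ.face ?_
    exact SimplexCategory.Hom.ext_one_left _ _ rfl rfl
  · rw [EquivSimplex.face_face]
    refine congrArg σ.face ?_
    exact SimplexCategory.Hom.ext_one_left _ _ rfl rfl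

/-- The representative `(id, σ ∘ (id × δ_{(2,…,n+1)}))` of the morphism `σ_* : σ_H ⟶ σ_H^{(0)}`. -/
def EquivSimplex.starPath {H : OrbitCat G} {n : ℕ} (σ : EquivSimplex X H (n + 1)) :
    FundGroupoid.Path σ.vertex (σ.face (SimplexCategory.δ 0)).vertex where
  orb := 𝟙 H
  path := σ.face (SimplexCategory.mkOfLe 0 1 (Fin.zero_le _))
  src := (vertexPath σ _ (𝟙 H) (SimplexCategory.δ 0) (EquivSimplex.pull_id _).symm).src
  tgt := (vertexPath σ _ (𝟙 H) (SimplexCategory.δ 0) (EquivSimplex.pull_id _).symm).tgt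

/-- For `η = τ ∘ (ĝ × id)`, the representative `(ĝ, η_H ∘ (id × σ_0))` of the
morphism `g_* : η_H ⟶ τ_K`. -/
def compatPath {H K : OrbitCat G} {n : ℕ} (η : EquivSimplex X H n) (τ : EquivSimplex X K n)
    (g : H ⟶ K) (h : τ.pull g = η) :
    FundGroupoid.Path η.vertex τ.vertex where
  orb := g
  path := η.vertex.pt.face (SimplexCategory.σ 0)
  src := (FundGroupoid.Path.const η.vertex).src
  tgt := by
    subst h
    exact (FundGroupoid.Path.const (τ.pull g).vertex).tgt.trans
      ((EquivSimplex.pull_id _).trans (EquivSimplex.pull_face _ _ _))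

lemma EquivSimplex.face_succ_vertex {H : OrbitCat G} {n : ℕ} (σ : EquivSimplex X H (n + 1))
    (j : Fin (n + 1)) : σ.vertex = (σ.face (SimplexCategory.δ j.succ)).vertex := by
  refine congrArg (FundGroupoid.mk H) ((congrArg σ.face ?_).trans (σ.face_face _ _).symm)
  ext i; fin_cases i; rfl

lemma vertexPath_eq_compatPath {H K : OrbitCat G} {n : ℕ} (η : EquivSimplex X H n)
    (τ : EquivSimplex X K n) (g : H ⟶ K) (h : τ.pull g = η) :
    vertexPath η τ g (𝟙 _) (by rw [h, EquivSimplex.face_id]) = compatPath η τ g h := by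
  refine FundGroupoid.Path.ext rfl ?_
  refine Eq.trans ?_ (EquivSimplex.face_face _ _ _).symm
  refine congrArg η.face ?_
  exact SimplexCategory.Hom.ext_one_left _ _ rfl rfl

variable [IsGKan X]

/-- The class of `vertexPath`. -/
def vertexHom {H K : OrbitCat G} {m n : ℕ} (σ : EquivSimplex X H n) (τ : EquivSimplex X K m)
    (g : H ⟶ K) (θ : ⦋m⦌ ⟶ ⦋n⦌) (h : σ.face θ = τ.pull g) : σ.vertex ⟶ τ.vertex :=
  FundGroupoid.homMk (vertexPath σ τ g θ h)

lemma vertexHom_comp {H K L : OrbitCat G} {m n k : ℕ} (σ : EquivSimplex X H n)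
    (τ : EquivSimplex X K m) (ρ : EquivSimplex X L k)
    (g : H ⟶ K) (θ : ⦋m⦌ ⟶ ⦋n⦌) (h : σ.face θ = τ.pull g)
    (g' : K ⟶ L) (θ' : ⦋k⦌ ⟶ ⦋m⦌) (h' : τ.face θ' = ρ.pull g') :
    vertexHom σ τ g θ h ≫ vertexHom τ ρ g' θ' h' =
      vertexHom σ ρ (g ≫ g') (θ' ≫ θ) (by
        rw [← EquivSimplex.face_face, h, EquivSimplex.pull_face, h', EquivSimplex.pull_pull]) :=
  FundGroupoid.homMk_comp (vertexPath_isComp σ τ ρ g θ h g' θ' h' _)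

lemma vertexHom_id {H : OrbitCat G} {n : ℕ} (σ : EquivSimplex X H n) :
    vertexHom σ σ (𝟙 H) (𝟙 _) (by rw [EquivSimplex.pull_id, EquivSimplex.face_id]) = 𝟙 _ := by
  rw [← FundGroupoid.homMk_const]
  refine congrArg FundGroupoid.homMk (FundGroupoid.Path.ext rfl ?_)
  exact congrArg FundGroupoid.Path.path
    (vertexPath_eq_compatPath σ σ (𝟙 H) (EquivSimplex.pull_id _))

lemma vertexHom_face_eq {H : OrbitCat G} {m n : ℕ} (σ : EquivSimplex X H n) (θ : ⦋m⦌ ⟶ ⦋n⦌)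
    (hθ : θ 0 = 0) (h : σ.vertex = (σ.face θ).vertex) :
    vertexHom σ (σ.face θ) (𝟙 H) θ (EquivSimplex.pull_id _).symm = eqToHom h := by
  have : ∀ (y : FundGroupoid X) (h : σ.vertex = y) (p : FundGroupoid.Path σ.vertex y)
      (horb : p.orb = (eqToHom (by rw [← h])))
      (hp : p.path = σ.vertex.pt.face (SimplexCategory.σ 0)), FundGroupoid.homMk p = eqToHom h := by
    rintro _ rfl p horb hp
    exact congrArg FundGroupoid.homMk (FundGroupoid.Path.ext horb hp)
  refine this _ h _ rfl ?_
  refine Eq.trans ?_ (σ.face_face _ _).symm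
  refine congrArg σ.face ?_
  refine SimplexCategory.Hom.ext_one_left _ _ rfl ?_
  exact hθ

/-- The morphism `σ_* : σ_H ⟶ σ_H^{(0)}`. -/
def EquivSimplex.star {H : OrbitCat G} {n : ℕ} (σ : EquivSimplex X H (n + 1)) :
    σ.vertex ⟶ (σ.face (SimplexCategory.δ 0)).vertex := FundGroupoid.homMk σ.starPath

/-- The morphism `g_* : η_H ⟶ τ_K` for `η` and `τ` compatible under `ĝ`. -/
def compatHom {H K : OrbitCat G} {n : ℕ} (η : EquivSimplex X H n) (τ : EquivSimplex X K n)
    (g : H ⟶ K) (h : τ.pull g = η) : η.vertex ⟶ τ.vertex := FundGroupoid.homMk (compatPath η τ g h)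

variable (M : (FundGroupoid X)ᵒᵖ ⥤ AddCommGrpCat.{u})

/-- All families `f(σ) ∈ M(σ_H)`, `σ` running over the equivariant `n`-simplices of all types. -/
abbrev Family (n : ℕ) : Type u :=
  ∀ (H : OrbitCat G) (σ : EquivSimplex X H n), M.obj (op σ.vertex)

/-- The coboundary
`(δf)(σ) = M(σ_*) f(σ^{(0)}) + ∑_{j = 1}^{n + 1} (-1)^j f(σ^{(j)})`;
here `f(σ^{(j)}) ∈ M(σ_H)` since `σ_H^{(j)} = σ_H` for `j > 0`. -/
noncomputable def coboundary (n : ℕ) : Family M n →+ Family M (n + 1) where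
  toFun f H σ := M.map σ.star.op (f H (σ.face (SimplexCategory.δ 0))) +
    ∑ j : Fin (n + 1), (-1 : ℤ) ^ (j.val + 1) •
      M.map (eqToHom (σ.face_succ_vertex j)).op (f H (σ.face (SimplexCategory.δ j.succ)))
  map_zero' := by
    funext H σ
    simp
  map_add' f f' := by
    funext H σ
    simp [Finset.sum_add_distrib]
    abel

variable {M}

lemma coboundary_eq {n : ℕ} (f : Family M n) (H : OrbitCat G) (σ : EquivSimplex X H (n + 1)) :
    coboundary M n f H σ = ∑ j : Fin (n + 2), (-1 : ℤ) ^ j.val •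
      M.map (vertexHom σ _ (𝟙 H) (SimplexCategory.δ j) (EquivSimplex.pull_id _).symm).op
        (f H (σ.face (SimplexCategory.δ j))) := by
  rw [Fin.sum_univ_succ]
  refine congrArg₂ (fun a b : M.obj (op σ.vertex) => a + b) ?_ ?_
  · simp only [Fin.val_zero, pow_zero, one_smul]
    rfl
  · refine Finset.sum_congr rfl fun j _ => ?_
    rw [vertexHom_face_eq σ (SimplexCategory.δ j.succ) rfl (σ.face_succ_vertex j)]
    rfl

lemma M_map_comp {x y z : FundGroupoid X} (f : x ⟶ y) (g : y ⟶ z) (a : M.obj (op z)) :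
    M.map (f ≫ g).op a = M.map f.op (M.map g.op a) :=
  congrArg (fun φ => φ a) (M.map_comp g.op f.op)

lemma M_map_id {x : FundGroupoid X} (a : M.obj (op x)) :
    M.map (𝟙 x).op a = a :=
  congrArg (fun φ => φ a) (M.map_id (op x))

lemma coboundary_coboundary {n : ℕ} (f : Family M n) :
    coboundary M (n + 1) (coboundary M n f) = 0 := by
  funext H σ
  rw [coboundary_eq]
  simp only [coboundary_eq, map_sum, map_zsmul, ← M_map_comp, vertexHom_comp]
  refine alternating_double_sum n (fun i j => M.map (vertexHom σ
    ((σ.face (SimplexCategory.δ i)).face (SimplexCategory.δ j)) (𝟙 H ≫ 𝟙 H)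
      (SimplexCategory.δ j ≫ SimplexCategory.δ i) _).op _) ?_
  intro i j hij
  have key : ∀ (θ θ' : ⦋n⦌ ⟶ ⦋n + 2⦌) (τ τ' : EquivSimplex X H n) (h) (h') (e : θ = θ')
      (e' : τ = τ'), M.map (vertexHom σ τ (𝟙 H ≫ 𝟙 H) θ h).op (f H τ) =
        M.map (vertexHom σ τ' (𝟙 H ≫ 𝟙 H) θ' h').op (f H τ') := by
    rintro _ _ _ _ _ _ rfl rfl; rfl
  have e := (SimplexCategory.δ_comp_δ hij).symm
  refine key _ _ _ _ _ _ e ?_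
  rw [EquivSimplex.face_face, EquivSimplex.face_face, e]

end BredonIllmanComplex

section BredonIllmanCohomology

variable {G : Type u} [Group G] {X : Action SSet.{u} G} [IsGKan X]
  (M : (FundGroupoid X)ᵒᵖ ⥤ AddCommGrpCat.{u})

/-- The group `C^n_G(X; M)` of the families vanishing on the degenerate simplices. -/
def cochains (n : ℕ) : AddSubgroup (Family M n) where
  carrier := {f | ∀ (H : OrbitCat G) (σ : EquivSimplex X H n), σ.IsDegenerate → f H σ = 0}
  zero_mem' _ _ _ := rfl
  add_mem' {f f'} hf hf' H σ hσ := by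
    change f H σ + f' H σ = 0
    rw [hf H σ hσ, hf' H σ hσ, add_zero]
  neg_mem' {f} hf H σ hσ := by
    change - f H σ = 0
    rw [hf H σ hσ, neg_zero]

/-- The subgroup `S^n_G(X; M)` of `C^n_G(X; M)` of those `f` with `f(η) = M(g_*) f(τ)` whenever
`η = τ ∘ (ĝ × id)`. -/
def invariantCochains (n : ℕ) : AddSubgroup (Family M n) where
  carrier := {f | f ∈ cochains M n ∧ ∀ (H K : OrbitCat G) (η : EquivSimplex X H n)
    (τ : EquivSimplex X K n) (g : H ⟶ K) (h : τ.pull g = η),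
      f H η = M.map (compatHom η τ g h).op (f K τ)}
  zero_mem' := ⟨zero_mem _, fun _ _ _ _ _ _ => (map_zero _).symm⟩
  add_mem' {f f'} hf hf' := ⟨add_mem hf.1 hf'.1, fun H K η τ g h => by
    change f H η + f' H η = M.map _ (f K τ + f' K τ)
    rw [hf.2 H K η τ g h, hf'.2 H K η τ g h, map_add]⟩
  neg_mem' {f} hf := ⟨neg_mem hf.1, fun H K η τ g h => by
    change - f H η = M.map _ (- f K τ)
    rw [hf.2 H K η τ g h, map_neg]⟩

variable {M}

lemma coboundary_mem_cochains {n : ℕ} {f : Family M n} (hf : f ∈ cochains M n) :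
    coboundary M n f ∈ cochains M (n + 1) := by
  intro H σ hσ
  rw [coboundary_eq]
  unfold EquivSimplex.IsDegenerate at hσ
  rw [SSet.degenerate_eq_iUnion_range_σ, Set.mem_iUnion] at hσ
  obtain ⟨i, x, hx⟩ := hσ
  obtain ⟨ρ, rfl⟩ := simplexEquiv.surjective x
  obtain rfl : ρ.face (SimplexCategory.σ i) = σ :=
    simplexEquiv.injective ((simplexEquiv_face _ _).trans hx)
  refine alternating_sum_pair n (fun j => M.map (vertexHom (ρ.face (SimplexCategory.σ i))
    ((ρ.face (SimplexCategory.σ i)).face (SimplexCategory.δ j)) (𝟙 H) _ _).op (f H _)) i ?_ ?_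
  · intro j hj hj'
    dsimp only
    rw [hf H _ ?_, map_zero]
    unfold EquivSimplex.IsDegenerate
    obtain ⟨m, rfl⟩ : ∃ m, n = m + 1 := by
      refine ⟨n - 1, ?_⟩
      by_contra hn
      obtain rfl : n = 0 := by omega
      fin_cases i; fin_cases j
      · exact hj rfl
      · exact hj' rfl
    rw [EquivSimplex.face_face]
    have : ∃ (k : Fin (m + 1)) (θ : ⦋m⦌ ⟶ ⦋m + 1⦌),
        SimplexCategory.δ j ≫ SimplexCategory.σ i = SimplexCategory.σ k ≫ θ := by
      rcases lt_or_gt_of_ne hj with h | h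
      · have hi : i ≠ 0 := by rintro rfl; simp at h
        obtain ⟨k, rfl⟩ := Fin.exists_succ_eq.2 hi
        have hjl : j ≠ Fin.last _ := (h.trans_le (Fin.le_last _)).ne
        obtain ⟨l, rfl⟩ := Fin.exists_castSucc_eq.2 hjl
        exact ⟨_, _, SimplexCategory.δ_comp_σ_of_le (i := l) (j := k) (by
          simp only [Fin.lt_def, Fin.le_def, Fin.val_castSucc, Fin.val_succ] at h ⊢; omega)⟩
      · have h2 : i.succ < j := by
          refine lt_of_le_of_ne ?_ (Ne.symm hj')
          simp only [Fin.lt_def, Fin.le_def, Fin.val_castSucc, Fin.val_succ] at h ⊢; omega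
        exact ⟨_, _, SimplexCategory.δ_comp_σ_of_gt' h2⟩
    obtain ⟨k, θ, e⟩ := this
    rw [e, ← EquivSimplex.face_face, simplexEquiv_face]
    exact SSet.σ_mem_degenerate _ k _
  · have key : ∀ (θ : ⦋n⦌ ⟶ ⦋n + 1⦌) (hθ : θ ≫ SimplexCategory.σ i = 𝟙 _)
        (τ : EquivSimplex X H n) (h : (ρ.face (SimplexCategory.σ i)).face θ = τ.pull (𝟙 H)),
        M.map (vertexHom ρ (ρ.face (SimplexCategory.σ i)) (𝟙 H) (SimplexCategory.σ i)
          (EquivSimplex.pull_id _).symm).op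
          (M.map (vertexHom (ρ.face (SimplexCategory.σ i)) τ (𝟙 H) θ h).op (f H τ)) = f H ρ := by
      intro θ hθ τ h
      have hτ : τ = ρ := by
        rw [EquivSimplex.pull_id, EquivSimplex.face_face, hθ, EquivSimplex.face_id] at h
        exact h.symm
      subst hτ
      rw [← M_map_comp, vertexHom_comp]
      refine Eq.trans ?_ (M_map_id (f H τ))
      refine congrArg (fun φ => M.map (Quiver.Hom.op φ) (f H τ)) ?_
      rw [← vertexHom_id]
      congr 1
    have hinj : Function.Injective (M.map (vertexHom ρ (ρ.face (SimplexCategory.σ i)) (𝟙 H)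
        (SimplexCategory.σ i) (EquivSimplex.pull_id _).symm).op) := by
      have hv : ρ.vertex = (ρ.face (SimplexCategory.σ i)).vertex := by
        refine congrArg (FundGroupoid.mk H) ((congrArg ρ.face ?_).trans (ρ.face_face _ _).symm)
        ext i; fin_cases i; rfl
      rw [vertexHom_face_eq ρ (SimplexCategory.σ i) rfl hv]
      intro a b hab
      have := congrArg (M.map (eqToHom hv.symm).op) hab
      rw [← M_map_comp, ← M_map_comp] at this
      simpa only [eqToHom_trans, eqToHom_refl, M_map_id] using this
    apply hinj
    dsimp only
    rw [key _ (SimplexCategory.δ_comp_σ_self' rfl), key _ (SimplexCategory.δ_comp_σ_succ' rfl)]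

lemma compatHom_eq {H K : OrbitCat G} {n : ℕ} (η : EquivSimplex X H n)
    (τ : EquivSimplex X K n) (g : H ⟶ K) (h : τ.pull g = η) : compatHom η τ g h =
      vertexHom η τ g (𝟙 _) (by rw [h, EquivSimplex.face_id]) :=
  congrArg FundGroupoid.homMk (vertexPath_eq_compatPath η τ g h).symm

lemma coboundary_mem {n : ℕ} {f : Family M n} (hf : f ∈ invariantCochains M n) :
    coboundary M n f ∈ invariantCochains M (n + 1) := by
  refine ⟨coboundary_mem_cochains hf.1, fun H K η τ g h => ?_⟩
  rw [coboundary_eq, coboundary_eq, map_sum]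
  refine Finset.sum_congr rfl fun j _ => ?_
  rw [map_zsmul]
  congr 1
  rw [hf.2 H K (η.face (SimplexCategory.δ j)) (τ.face (SimplexCategory.δ j)) g
    (by rw [← h, EquivSimplex.pull_face]), compatHom_eq, compatHom_eq, ← M_map_comp, ← M_map_comp,
    vertexHom_comp, vertexHom_comp]
  have : ∀ (k k' : H ⟶ K) (θ θ' : ⦋n⦌ ⟶ ⦋n + 1⦌) (h h') (e : k = k') (e' : θ = θ')
      (a : M.obj (op (τ.face (SimplexCategory.δ j)).vertex)),
      M.map (vertexHom η (τ.face (SimplexCategory.δ j)) k θ h).op a =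
        M.map (vertexHom η (τ.face (SimplexCategory.δ j)) k' θ' h').op a := by
    rintro _ _ _ _ _ _ rfl rfl _; rfl
  exact this _ _ _ _ _ _ ((Category.id_comp _).trans (Category.comp_id _).symm)
    ((Category.id_comp _).trans (Category.comp_id _).symm) _

variable (X M) in
/-- The cochain complex `S_G(X; M)`. -/
noncomputable def bredonIllmanComplex : CochainComplex AddCommGrpCat.{u} ℕ :=
  CochainComplex.of (fun n => AddCommGrpCat.of (invariantCochains M n))
    (fun n => AddCommGrpCat.ofHom (((coboundary M n).comp (invariantCochains M n).subtype).codRestrict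
      (invariantCochains M (n + 1)) fun f => coboundary_mem f.2))
    (fun n => by
      refine ConcreteCategory.hom_ext _ _ fun (f : invariantCochains M n) => ?_
      exact Subtype.ext (coboundary_coboundary f.1))

variable (X M) in
/-- The simplicial Bredon–Illman cohomology `H^n_G(X; M)` with local coefficients. -/
noncomputable def bredonIllmanCohomology (n : ℕ) : AddCommGrpCat.{u} :=
  (bredonIllmanComplex X M).homology n

end BredonIllmanCohomology

noncomputable section UniversalCover

section
variable {Y : SSet.{u}} [SSet.KanComplex Y]

noncomputable instance : Groupoid (FundamentalGroupoid₀ Y) := Groupoid.ofIsGroupoid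

end

variable (Y Z W : SSet.{u}) [SSet.KanComplex Y] [Unique (Y _⦋0⦌)] [SSet.KanComplex Z]
  [Unique (Z _⦋0⦌)] [SSet.KanComplex W] [Unique (W _⦋0⦌)]

/-- The fundamental group `π₁(Y, v)` of a one vertex Kan complex; the product is the composition
of morphisms: `α * β` is `β` followed by `α`. -/
abbrev FundamentalGroup₀ : Type u := End (fpt Y default)

variable {Y Z W}

/-- A `1`-simplex as an edge from the vertex `v` to itself. -/
def loopEdge (x : Y _⦋1⦌) : SSet.Edge (default : Y _⦋0⦌) default :=
  SSet.Edge.mk x (Subsingleton.elim _ _) (Subsingleton.elim _ _)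

/-- The element `[x]` of `π₁(Y, v)` represented by a `1`-simplex `x`. -/
def loopClass (x : Y _⦋1⦌) : FundamentalGroup₀ Y :=
  edgeClass (loopEdge x)

lemma loopClass_surjective (γ : FundamentalGroup₀ Y) : ∃ x, loopClass x = γ := by
  obtain ⟨e, rfl⟩ := edgeClass_surjective γ
  exact ⟨e.edge, rfl⟩

lemma loopClass_mul (s : Y _⦋2⦌) :
    loopClass (Y.δ 0 s) * loopClass (Y.δ 2 s) = loopClass (Y.δ 1 s) :=
  (exists_comp_iff _ _ _).2 ⟨s, rfl, rfl, rfl⟩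

lemma loopClass_eq_iff (x y : Y _⦋1⦌) : loopClass x = loopClass y ↔
    ∃ s : Y _⦋2⦌, Y.δ 2 s = x ∧ Y.δ 0 s = Y.σ 0 default ∧ Y.δ 1 s = y := by
  refine Iff.trans ?_ (exists_comp_iff (loopEdge x) (SSet.Edge.id default) (loopEdge y))
  exact ⟨fun h => (Category.comp_id _).trans h, fun h => (Category.comp_id _).symm.trans h⟩

lemma loopClass_one : loopClass (Y.σ 0 default) = 1 :=
  edgeClass_id default

/-- The homomorphism of fundamental groups `[x] ↦ [f(x)]` induced by a simplicial map. -/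
def FundamentalGroup₀.map (f : Y ⟶ Z) : FundamentalGroup₀ Y →* FundamentalGroup₀ Z where
  toFun := Quotient.lift (fun e => loopClass (f.app (op ⦋1⦌) (show Y _⦋1⦌ from e.edge))) fun e e' h => by
    have : loopClass e.edge = loopClass e'.edge := Quotient.sound h
    obtain ⟨s, h₂, h₀, h₁⟩ := (loopClass_eq_iff _ _).1 this
    refine (loopClass_eq_iff _ _).2 ⟨f.app _ s, ?_, ?_, ?_⟩
    · exact (NatTrans.naturality_apply f (SimplexCategory.δ 2).op s).symm.trans (congrArg _ h₂)
    · refine (NatTrans.naturality_apply f (SimplexCategory.δ 0).op s).symm.trans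
        ((congrArg _ h₀).trans ((NatTrans.naturality_apply f (SimplexCategory.σ 0).op _).trans ?_))
      exact congrArg _ (Subsingleton.elim _ _)
    · exact (NatTrans.naturality_apply f (SimplexCategory.δ 1).op s).symm.trans (congrArg _ h₁)
  map_one' := by
    refine Eq.trans ?_ loopClass_one
    refine congrArg loopClass ((NatTrans.naturality_apply f (SimplexCategory.σ 0).op _).trans ?_)
    exact congrArg _ (Subsingleton.elim _ _)
  map_mul' α β := by
    obtain ⟨x, rfl⟩ := loopClass_surjective α
    obtain ⟨y, rfl⟩ := loopClass_surjective β
    obtain ⟨⟨e, h⟩⟩ := fill21 (loopEdge y) (loopEdge x)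
    obtain ⟨s, h0, h2⟩ : ∃ s : Y _⦋2⦌, Y.δ 0 s = x ∧ Y.δ 2 s = y := ⟨h.simplex, h.d₀, h.d₂⟩
    subst h0 h2
    rw [loopClass_mul]
    refine Eq.symm (Eq.trans ?_ ((loopClass_mul (f.app _ s)).trans ?_))
    · exact congrArg₂ (fun a b => loopClass a * loopClass b)
        (NatTrans.naturality_apply f (SimplexCategory.δ 0).op s)
        (NatTrans.naturality_apply f (SimplexCategory.δ 2).op s)
    · exact congrArg loopClass
        (NatTrans.naturality_apply f (SimplexCategory.δ 1).op s).symm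

lemma FundamentalGroup₀.map_loopClass (f : Y ⟶ Z) (x : Y _⦋1⦌) :
    FundamentalGroup₀.map f (loopClass x) = loopClass (f.app (op ⦋1⦌) x) := rfl

/-- The class of the edge of `x` from the vertex `i` to the vertex `j`. -/
def edgeLoop {n : ℕ} (x : Y _⦋n⦌) (i j : Fin (n + 1)) (h : i ≤ j) : FundamentalGroup₀ Y :=
  loopClass (Y.map (SimplexCategory.mkOfLe i j h).op x)

lemma edgeLoop_self {n : ℕ} (x : Y _⦋n⦌) (i : Fin (n + 1)) : edgeLoop x i i le_rfl = 1 := by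
  refine Eq.trans (congrArg loopClass ?_) loopClass_one
  have : SimplexCategory.mkOfLe i i le_rfl =
      SimplexCategory.σ 0 ≫ SimplexCategory.const ⦋0⦌ ⦋n⦌ i :=
    SimplexCategory.Hom.ext_one_left _ _ rfl rfl
  rw [this, op_comp, smap_comp]
  exact congrArg (Y.map (SimplexCategory.σ 0).op) (Subsingleton.elim _ _)

lemma edgeLoop_mul {n : ℕ} (x : Y _⦋n⦌) (i j k : Fin (n + 1)) (h : i ≤ j) (h' : j ≤ k) :
    edgeLoop x j k h' * edgeLoop x i j h = edgeLoop x i k (h.trans h') := by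
  refine Eq.trans ?_ ((loopClass_mul
    (Y.map (SimplexCategory.mkOfLeComp i j k h h').op x)).trans ?_)
  · refine congrArg₂ (fun a b => loopClass a * loopClass b) ?_ ?_
    · refine Eq.trans ?_ (smap_comp Y _ _ _)
      exact congrArg (fun θ : ⦋1⦌ ⟶ ⦋n⦌ => Y.map θ.op x)
        (SimplexCategory.Hom.ext_one_left _ _ rfl rfl)
    · refine Eq.trans ?_ (smap_comp Y _ _ _)
      exact congrArg (fun θ : ⦋1⦌ ⟶ ⦋n⦌ => Y.map θ.op x)
        (SimplexCategory.Hom.ext_one_left _ _ rfl rfl)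
  · refine congrArg loopClass ((smap_comp Y _ _ _).symm.trans ?_)
    exact congrArg (fun θ : ⦋1⦌ ⟶ ⦋n⦌ => Y.map θ.op x)
        (SimplexCategory.Hom.ext_one_left _ _ rfl rfl)

lemma edgeLoop_map {m n : ℕ} (θ : ⦋m⦌ ⟶ ⦋n⦌) (x : Y _⦋n⦌) (i j : Fin (m + 1)) (h : i ≤ j) :
    edgeLoop (Y.map θ.op x) i j h = edgeLoop x (θ i) (θ j) (θ.toOrderHom.monotone h) := by
  refine congrArg loopClass ((smap_comp Y _ _ _).symm.trans ?_)
  exact congrArg (fun θ : ⦋1⦌ ⟶ ⦋n⦌ => Y.map θ.op x)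
        (SimplexCategory.Hom.ext_one_left _ _ rfl rfl)

lemma edgeLoop_app {n : ℕ} (f : Y ⟶ Z) (x : Y _⦋n⦌) (i j : Fin (n + 1)) (h : i ≤ j) :
    FundamentalGroup₀.map f (edgeLoop x i j h) = edgeLoop (f.app _ x) i j h :=
  congrArg loopClass (NatTrans.naturality_apply f (SimplexCategory.mkOfLe i j h).op x)

variable (Y) in
/-- The universal covering complex of a one vertex Kan complex `Y`: the `n`-simplices are the
pairs `(γ, x)` with `γ ∈ π₁(Y, v)` and `x ∈ Y_n`, and the simplicial structure is determined by the
formulas `cover_δ_zero`, `cover_δ_succ` and `cover_σ` below. A monotone map `θ` sends `(γ, x)` to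
`([e] γ, θ^* x)` where `e` is the edge of `x` from `0` to `θ(0)`. -/
def cover : SSet.{u} where
  obj q := FundamentalGroup₀ Y × Y.obj q
  map {q r} θ := ↾fun p => (edgeLoop (n := q.unop.len) p.2 0 (θ.unop 0) (Fin.zero_le _) * p.1,
    Y.map θ p.2)
  map_id q := by
    refine type_hom_ext fun p => ?_
    obtain ⟨γ, x⟩ := p
    refine Prod.ext ?_ (smap_id Y x)
    exact (congrArg (· * γ) (edgeLoop_self _ _)).trans (one_mul γ)
  map_comp {q r s} θ θ' := by
    refine type_hom_ext fun p => ?_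
    obtain ⟨γ, x⟩ := p
    refine Prod.ext ?_ (smap_comp Y θ θ' x)
    have h1 := edgeLoop_map (m := r.unop.len) (n := q.unop.len) θ.unop x 0 (θ'.unop 0)
      (Fin.zero_le _)
    have h2 := edgeLoop_mul (n := q.unop.len) x 0 (θ.unop 0) (θ.unop (θ'.unop 0)) (Fin.zero_le _)
      (θ.unop.toOrderHom.monotone (Fin.zero_le _))
    refine ((congrArg (· * γ) h2).symm.trans (mul_assoc _ _ _)).trans ?_
    exact congrArg (· * _) h1.symm

/-- The simplex `(γ, x)` of the universal covering complex. -/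
def coverPt {q : SimplexCategoryᵒᵖ} (γ : FundamentalGroup₀ Y) (x : Y.obj q) : (cover Y).obj q :=
  (γ, x)

/-- `∂₀(γ, x) = ([∂_{(2,…,n)} x] γ, ∂₀ x)`; the edge `∂_{(2,…,n)} x` goes from the vertex `0`
of `x` to the vertex `1`. -/
lemma cover_δ_zero {n : ℕ} (γ : FundamentalGroup₀ Y) (x : Y _⦋n + 1⦌) :
    (cover Y).δ 0 (coverPt γ x) =
      coverPt (loopClass (Y.map (SimplexCategory.mkOfLe 0 1 (Fin.zero_le _)).op x) * γ)
        (Y.δ 0 x) := rfl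

lemma cover_δ_succ {n : ℕ} (γ : FundamentalGroup₀ Y) (x : Y _⦋n + 1⦌) (i : Fin (n + 1)) :
    (cover Y).δ i.succ (coverPt γ x) = coverPt γ (Y.δ i.succ x) :=
  congrArg (fun α => coverPt α (Y.δ i.succ x))
    ((congrArg (· * γ) (edgeLoop_self x 0)).trans (one_mul γ))

lemma cover_σ {n : ℕ} (γ : FundamentalGroup₀ Y) (x : Y _⦋n⦌) (i : Fin (n + 1)) :
    (cover Y).σ i (coverPt γ x) = coverPt γ (Y.σ i x) :=
  congrArg (fun α => coverPt α (Y.σ i x))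
    ((congrArg (· * γ) (edgeLoop_self x 0)).trans (one_mul γ))

/-- The map `(γ, x) ↦ (f_* γ, f(x))` of universal covering complexes. -/
def coverMap (f : Y ⟶ Z) : cover Y ⟶ cover Z where
  app q := ↾fun p => (FundamentalGroup₀.map f p.1, f.app q p.2)
  naturality q r θ := by
    refine type_hom_ext fun p => ?_
    obtain ⟨γ, (x : Y.obj q)⟩ := p
    refine Prod.ext ?_ ?_
    swap
    · exact NatTrans.naturality_apply f θ x
    refine (map_mul (FundamentalGroup₀.map f) _ γ).trans ?_
    exact congrArg (· * _) (edgeLoop_app (n := q.unop.len) f x 0 (θ.unop 0) (Fin.zero_le _))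

lemma coverMap_app (f : Y ⟶ Z) {q : SimplexCategoryᵒᵖ} (γ : FundamentalGroup₀ Y) (x : Y.obj q) :
    (coverMap f).app q (coverPt γ x) = coverPt (FundamentalGroup₀.map f γ) (f.app q x) := rfl

lemma coverMap_id : coverMap (𝟙 Y) = 𝟙 _ := by
  refine sset_hom_ext fun q p => ?_
  obtain ⟨γ, x⟩ := p
  obtain ⟨y, rfl⟩ := loopClass_surjective γ
  rfl

lemma coverMap_comp (f : Y ⟶ Z) (g : Z ⟶ W) : coverMap (f ≫ g) = coverMap f ≫ coverMap g := by
  refine sset_hom_ext fun q p => ?_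
  obtain ⟨γ, x⟩ := p
  obtain ⟨y, rfl⟩ := loopClass_surjective γ
  rfl

/-- The action of `σ ∈ π₁(Y, v)` on the universal covering complex: `(γ, x) ↦ (γ σ⁻¹, x)`. -/
def coverAct (α : FundamentalGroup₀ Y) : cover Y ⟶ cover Y where
  app q := ↾fun p => (p.1 * α⁻¹, p.2)
  naturality q r θ := by
    refine type_hom_ext fun p => ?_
    obtain ⟨γ, (x : Y.obj q)⟩ := p
    refine congrArg (fun β => coverPt β (Y.map θ x)) ?_
    exact (mul_assoc (edgeLoop (n := q.unop.len) x 0 (θ.unop 0) (Fin.zero_le _)) γ α⁻¹)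

lemma coverAct_app (α : FundamentalGroup₀ Y) {q : SimplexCategoryᵒᵖ} (γ : FundamentalGroup₀ Y)
    (x : Y.obj q) : (coverAct α).app q (coverPt γ x) = coverPt (γ * α⁻¹) x := rfl

end UniversalCover

noncomputable section NormalizedChains

variable (Y Z W : SSet.{u})

/-- The group `C_n(Y; ℤ)`: the free abelian group on the nondegenerate `n`-simplices of `Y`. -/
abbrev Chains (n : ℕ) : Type u := FreeAbelianGroup (Y.nonDegenerate n)

variable {Y Z W}

open Classical in
/-- The class of an `n`-simplex in `C_n(Y; ℤ)`: a generator if it is nondegenerate and `0` if it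
is degenerate. -/
def gen {n : ℕ} (y : Y _⦋n⦌) : Chains Y n :=
  if h : y ∈ Y.nonDegenerate n then FreeAbelianGroup.of ⟨y, h⟩ else 0

lemma gen_coe {n : ℕ} (y : Y.nonDegenerate n) : gen y.1 = FreeAbelianGroup.of y := dif_pos y.2

lemma gen_eq_zero {n : ℕ} {y : Y _⦋n⦌} (h : y ∈ Y.degenerate n) : gen y = 0 :=
  dif_neg (fun h' => h' h)

lemma chains_hom_ext {n : ℕ} {A : Type*} [AddCommGroup A] {f g : Chains Y n →+ A}
    (h : ∀ y : Y _⦋n⦌, f (gen y) = g (gen y)) : f = g := by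
  refine FreeAbelianGroup.lift_ext _ _ fun y => ?_
  rw [← gen_coe]
  exact h y.1

variable (Y) in
/-- The boundary map `∂ y = ∑_{j = 0}^{n + 1} (-1)^j ∂_j y`. -/
def boundary (n : ℕ) : Chains Y (n + 1) →+ Chains Y n :=
  FreeAbelianGroup.lift fun y => ∑ j : Fin (n + 2), (-1 : ℤ) ^ j.val • gen (Y.δ j y.1)

lemma δ_σ_mem_degenerate {n : ℕ} (i : Fin (n + 1)) (j : Fin (n + 2)) (hj : j ≠ i.castSucc)
    (hj' : j ≠ i.succ) (x : Y _⦋n⦌) : Y.δ j (Y.σ i x) ∈ Y.degenerate n := by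
  obtain ⟨m, rfl⟩ : ∃ m, n = m + 1 := by
    refine ⟨n - 1, ?_⟩
    by_contra hn
    obtain rfl : n = 0 := by omega
    fin_cases i; fin_cases j
    · exact hj rfl
    · exact hj' rfl
  rcases lt_or_gt_of_ne hj with h | h
  · have hi : i ≠ 0 := by rintro rfl; simp at h
    obtain ⟨k, rfl⟩ := Fin.exists_succ_eq.2 hi
    have hjl : j ≠ Fin.last _ := (h.trans_le (Fin.le_last _)).ne
    obtain ⟨l, rfl⟩ := Fin.exists_castSucc_eq.2 hjl
    rw [SSet.δ_comp_σ_of_le_apply (i := l) (j := k) (by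
          simp only [Fin.lt_def, Fin.le_def, Fin.val_castSucc, Fin.val_succ] at h ⊢; omega)]
    exact SSet.σ_mem_degenerate _ _ _
  · have h2 : i.succ < j := by
      refine lt_of_le_of_ne ?_ (Ne.symm hj')
      simp only [Fin.lt_def, Fin.le_def, Fin.val_castSucc, Fin.val_succ] at h ⊢; omega
    rw [SSet.δ_comp_σ_of_gt'_apply h2]
    exact SSet.σ_mem_degenerate _ _ _

lemma boundary_gen {n : ℕ} (y : Y _⦋n + 1⦌) :
    boundary Y n (gen y) = ∑ j : Fin (n + 2), (-1 : ℤ) ^ j.val • gen (Y.δ j y) := by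
  by_cases h : y ∈ Y.nonDegenerate (n + 1)
  · exact (congrArg _ (gen_coe ⟨y, h⟩)).trans (FreeAbelianGroup.lift_apply_of _ _)
  · have h' : y ∈ Y.degenerate (n + 1) := not_not.1 h
    rw [gen_eq_zero h', map_zero]
    rw [SSet.degenerate_eq_iUnion_range_σ, Set.mem_iUnion] at h'
    obtain ⟨i, x, rfl⟩ := h'
    refine (alternating_sum_pair n _ i (fun j hj hj' => gen_eq_zero
      (δ_σ_mem_degenerate i j hj hj' x)) ?_).symm
    rw [SSet.δ_comp_σ_self_apply, SSet.δ_comp_σ_succ_apply]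

lemma boundary_boundary (n : ℕ) : (boundary Y n).comp (boundary Y (n + 1)) = 0 := by
  refine chains_hom_ext fun y => ?_
  rw [AddMonoidHom.comp_apply, boundary_gen, map_sum]
  simp only [map_zsmul, boundary_gen]
  exact alternating_double_sum n (fun i j => gen (Y.δ j (Y.δ i y))) fun i j hij =>
    congrArg gen (SSet.δ_comp_δ_apply hij y).symm

/-- The map `f_#` induced on chains by a simplicial map. -/
def chainsMap (f : Y ⟶ Z) (n : ℕ) : Chains Y n →+ Chains Z n :=
  FreeAbelianGroup.lift fun y => gen (f.app _ y.1)

lemma chainsMap_gen (f : Y ⟶ Z) {n : ℕ} (y : Y _⦋n⦌) :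
    chainsMap f n (gen y) = gen (f.app _ y) := by
  by_cases h : y ∈ Y.nonDegenerate n
  · exact (congrArg _ (gen_coe ⟨y, h⟩)).trans (FreeAbelianGroup.lift_apply_of _ _)
  · have h' : y ∈ Y.degenerate n := not_not.1 h
    rw [gen_eq_zero h', map_zero, gen_eq_zero (SSet.degenerate_app_apply h' f)]

lemma chainsMap_id (n : ℕ) : chainsMap (𝟙 Y) n = AddMonoidHom.id _ :=
  chains_hom_ext fun y => chainsMap_gen _ y

lemma chainsMap_comp (f : Y ⟶ Z) (g : Z ⟶ W) (n : ℕ) :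
    chainsMap (f ≫ g) n = (chainsMap g n).comp (chainsMap f n) :=
  chains_hom_ext fun y => by
    rw [AddMonoidHom.comp_apply, chainsMap_gen, chainsMap_gen, chainsMap_gen]
    rfl

lemma boundary_chainsMap (f : Y ⟶ Z) (n : ℕ) :
    (boundary Z n).comp (chainsMap f (n + 1)) = (chainsMap f n).comp (boundary Y n) :=
  chains_hom_ext fun y => by
    rw [AddMonoidHom.comp_apply, AddMonoidHom.comp_apply, chainsMap_gen, boundary_gen,
      boundary_gen, map_sum]
    refine Finset.sum_congr rfl fun j _ => ?_
    rw [map_zsmul, chainsMap_gen]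
    exact congrArg (fun z => (-1 : ℤ) ^ j.val • gen z)
      (NatTrans.naturality_apply f (SimplexCategory.δ j).op y).symm

end NormalizedChains

noncomputable section CoverCohomology

variable {G : Type u} [Group G] (X : Action SSet.{u} G) [Unique (X.V _⦋0⦌)]

/-- The vertex `v` of `X` is fixed by `G`, and it is the only vertex of each `X^H`. -/
instance (H : OrbitCat G) : Unique ((fixed X H : SSet.{u}) _⦋0⦌) where
  default := ⟨(default : X.V _⦋0⦌), fun _ _ => Subsingleton.elim _ _⟩
  uniq x := Subtype.ext (Subsingleton.elim (α := X.V _⦋0⦌) _ _)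

variable [IsGKan X]

/-- The universal `O_G`-covering complex: `G/H` is sent to the universal covering complex
of `X^H`. -/
def universalCover : (OrbitCat G)ᵒᵖ ⥤ SSet.{u} where
  obj H := cover (fixed X H.unop)
  map g := coverMap (translate X g.unop)
  map_id H := (congrArg coverMap (show translate X (𝟙 H.unop) = 𝟙 _ from
    (fixedFunctor X).map_id H)).trans coverMap_id
  map_comp g g' := (congrArg coverMap (show translate X (g'.unop ≫ g.unop) =
    translate X g.unop ≫ translate X g'.unop from (fixedFunctor X).map_comp g g')).trans
      (coverMap_comp _ _)

/-- The functor `G/H ↦ C_n(X̃(G/H); ℤ)`. -/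
def coverChains (n : ℕ) : (OrbitCat G)ᵒᵖ ⥤ AddCommGrpCat.{u} where
  obj H := AddCommGrpCat.of (Chains ((universalCover X).obj H) n)
  map g := AddCommGrpCat.ofHom (chainsMap ((universalCover X).map g) n)
  map_id H := by
    rw [CategoryTheory.Functor.map_id, chainsMap_id]
    rfl
  map_comp g g' := by
    rw [CategoryTheory.Functor.map_comp, chainsMap_comp]
    rfl

/-- The boundary of the chain complex of `X̃`. -/
def coverBoundary (n : ℕ) : coverChains X (n + 1) ⟶ coverChains X n where
  app H := AddCommGrpCat.ofHom (boundary ((universalCover X).obj H) n)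
  naturality H K g := congrArg AddCommGrpCat.ofHom
    (boundary_chainsMap ((universalCover X).map g) n)

lemma coverBoundary_coverBoundary (n : ℕ) :
    coverBoundary X (n + 1) ≫ coverBoundary X n = 0 := by
  ext H : 2
  exact congrArg AddCommGrpCat.ofHom (boundary_boundary n)

/-- The object `v_H` of `ΠX`. -/
abbrev basePoint (H : OrbitCat G) : FundGroupoid X := ⟨H, simplexEquiv.symm default⟩

variable {X}

/-- The morphism `[ĝ, k] : v_H ⟶ v_K` with `k(eH, Δ_1) = s_0 v`, as a pair. -/
def basePath {H K : OrbitCat G} (g : H ⟶ K) : FundGroupoid.Path (basePoint X H) (basePoint X K) where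
  orb := g
  path := simplexEquiv.symm ((fixed X H : SSet.{u}).σ 0 default)
  src := simplexEquiv.injective (Subsingleton.elim _ _)
  tgt := simplexEquiv.injective (Subsingleton.elim _ _)

/-- The pair `(id, φ)` with `φ(eH, Δ_1) = x`. -/
def loopPath {H : OrbitCat G} (x : (fixed X H : SSet.{u}) _⦋1⦌) :
    FundGroupoid.Path (basePoint X H) (basePoint X H) where
  orb := 𝟙 H
  path := simplexEquiv.symm x
  src := simplexEquiv.injective (Subsingleton.elim _ _)
  tgt := simplexEquiv.injective (Subsingleton.elim _ _)

/-- The degenerate `n`-simplex on `v`. -/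
def constSimplex (X : Action SSet.{u} G) [Unique (X.V _⦋0⦌)] (H : OrbitCat G) (n : ℕ) :
    (fixed X H : SSet.{u}) _⦋n⦌ :=
  (fixed X H : SSet.{u}).map (SimplexCategory.const ⦋n⦌ ⦋0⦌ 0).op default

lemma constSimplex_map (H : OrbitCat G) {m n : ℕ} (θ : ⦋m⦌ ⟶ ⦋n⦌) :
    (fixed X H : SSet.{u}).map θ.op (constSimplex X H n) = constSimplex X H m :=
  (smap_comp _ _ _ _).symm

lemma constSimplex_translate {H K : OrbitCat G} (g : H ⟶ K) (n : ℕ) :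
    (translate X g).app _ (constSimplex X K n) = constSimplex X H n :=
  (translate_map g _ _).trans (congrArg _ (Subsingleton.elim _ _))

lemma σ_default (H : OrbitCat G) : (fixed X H : SSet.{u}).σ 0 default = constSimplex X H 1 :=
  congrArg (fun θ : ⦋1⦌ ⟶ ⦋0⦌ => (fixed X H : SSet.{u}).map θ.op default) (Subsingleton.elim _ _)

lemma basePath_isComp {H K L : OrbitCat G} (g : H ⟶ K) (g' : K ⟶ L) :
    FundGroupoid.IsComp (basePath (X := X) g) (basePath g') (basePath (g ≫ g')) := by
  refine ⟨rfl, simplexEquiv.symm (constSimplex X H 2), ?_, ?_, ?_⟩ <;>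
    apply simplexEquiv.injective
  · rw [simplexEquiv_face, simplexEquiv_pull, Equiv.apply_symm_apply, constSimplex_map]
    change _ = (translate X g).app _ (simplexEquiv (simplexEquiv.symm _))
    rw [Equiv.apply_symm_apply, σ_default, constSimplex_translate]
  · rw [simplexEquiv_face, Equiv.apply_symm_apply, constSimplex_map]
    change _ = simplexEquiv (simplexEquiv.symm _)
    rw [Equiv.apply_symm_apply, σ_default]
  · rw [simplexEquiv_face, Equiv.apply_symm_apply, constSimplex_map]
    change _ = simplexEquiv (simplexEquiv.symm _)
    rw [Equiv.apply_symm_apply, σ_default]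

lemma basePath_id (H : OrbitCat G) :
    basePath (𝟙 H) = FundGroupoid.Path.const (basePoint X H) := by
  refine FundGroupoid.Path.ext rfl (simplexEquiv.injective ?_)
  refine (Equiv.apply_symm_apply _ _).trans (Eq.symm ?_)
  refine (simplexEquiv_face _ _).trans ?_
  rw [Equiv.apply_symm_apply]
  rfl

lemma loopPath_isComp {H : OrbitCat G} (s : (fixed X H : SSet.{u}) _⦋2⦌) :
    FundGroupoid.IsComp (loopPath ((fixed X H : SSet.{u}).δ 2 s))
      (loopPath ((fixed X H : SSet.{u}).δ 0 s)) (loopPath ((fixed X H : SSet.{u}).δ 1 s)) := by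
  refine ⟨(Category.id_comp _).symm, simplexEquiv.symm s, ?_, ?_, ?_⟩ <;>
    apply simplexEquiv.injective
  · rw [simplexEquiv_face]
    change _ = simplexEquiv (EquivSimplex.pull (simplexEquiv.symm _) (𝟙 H))
    rw [EquivSimplex.pull_id, Equiv.apply_symm_apply, Equiv.apply_symm_apply]
    rfl
  · rw [simplexEquiv_face]
    change _ = simplexEquiv (simplexEquiv.symm _)
    rw [Equiv.apply_symm_apply, Equiv.apply_symm_apply]
    rfl
  · rw [simplexEquiv_face]
    change _ = simplexEquiv (simplexEquiv.symm _)
    rw [Equiv.apply_symm_apply, Equiv.apply_symm_apply]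
    rfl

lemma loopPath_one (H : OrbitCat G) :
    loopPath ((fixed X H : SSet.{u}).σ 0 default) = FundGroupoid.Path.const (basePoint X H) :=
  basePath_id H

variable (X) in
/-- The functor `O_G ⥤ ΠX` sending `G/H` to `v_H` and `ĝ` to `[ĝ, k]`. -/
def baseFunctor : OrbitCat G ⥤ FundGroupoid X where
  obj H := basePoint X H
  map g := FundGroupoid.homMk (basePath g)
  map_id H := congrArg FundGroupoid.homMk (basePath_id H)
  map_comp g g' := (FundGroupoid.homMk_comp (basePath_isComp g g')).symm

/-- The homomorphism `[x] ↦ [id, φ]`, `φ(eH, Δ_1) = x`, from `π₁(X^H, v)` to the endomorphisms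
of `v_H` in `ΠX`. -/
def loopHom (H : OrbitCat G) :
    FundamentalGroup₀ (fixed X H : SSet.{u}) →* End (basePoint X H) where
  toFun := Quotient.lift (fun e => FundGroupoid.homMk
      (loopPath (show (fixed X H : SSet.{u}) _⦋1⦌ from e.edge))) fun e e' h => by
    have : loopClass (Y := (fixed X H : SSet.{u})) e.edge = loopClass e'.edge := Quotient.sound h
    obtain ⟨s, h₂, h₀, h₁⟩ := (loopClass_eq_iff _ _).1 this
    have := FundGroupoid.homMk_comp (loopPath_isComp s)
    rw [h₂, h₀, h₁, loopPath_one, FundGroupoid.homMk_const] at this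
    exact (Category.comp_id _).symm.trans this
  map_one' := congrArg FundGroupoid.homMk (loopPath_one H)
  map_mul' α β := by
    obtain ⟨x, rfl⟩ := loopClass_surjective α
    obtain ⟨y, rfl⟩ := loopClass_surjective β
    obtain ⟨⟨e, h⟩⟩ := fill21 (loopEdge y) (loopEdge x)
    obtain ⟨s, h0, h2⟩ : ∃ s : (fixed X H : SSet.{u}) _⦋2⦌, (fixed X H : SSet.{u}).δ 0 s = x ∧
      (fixed X H : SSet.{u}).δ 2 s = y := ⟨h.simplex, h.d₀, h.d₂⟩
    subst h0 h2
    rw [loopClass_mul]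
    exact (FundGroupoid.homMk_comp (loopPath_isComp s)).symm

lemma loopHom_loopClass {H : OrbitCat G} (x : (fixed X H : SSet.{u}) _⦋1⦌) :
    loopHom H (loopClass x) = FundGroupoid.homMk (loopPath x) := rfl

/-- The homomorphism `b : π₁(X^H, v) ⟶ Aut(v_H)`. -/
def loopAut (H : OrbitCat G) :
    FundamentalGroup₀ (fixed X H : SSet.{u}) →* Aut (basePoint X H) :=
  (Aut.unitsEndEquivAut (basePoint X H)).toMonoidHom.comp (loopHom H).toHomUnits

lemma loopAut_hom (H : OrbitCat G) (γ : FundamentalGroup₀ (fixed X H : SSet.{u})) :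
    (loopAut H γ).hom = loopHom H γ := rfl

variable (X) (M : (FundGroupoid X)ᵒᵖ ⥤ AddCommGrpCat.{u})

/-- The abelian `O_G`-group `M₀`, `M₀(G/H) = M(v_H)` and `M₀(ĝ) = M([ĝ, k])`. -/
abbrev baseCoeff : (OrbitCat G)ᵒᵖ ⥤ AddCommGrpCat.{u} := (baseFunctor X).op ⋙ M

/-- The action of `γ ∈ π₁(X^H, v)` on `M₀(G/H)`, by `M(b(γ))⁻¹`. -/
def coeffAct {H : OrbitCat G} (γ : FundamentalGroup₀ (fixed X H : SSet.{u})) :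
    (baseCoeff X M).obj (op H) ⟶ (baseCoeff X M).obj (op H) :=
  M.map (loopAut H γ).inv.op

/-- The action of `γ ∈ π₁(X^H, v)` on `C_n(X̃(G/H); ℤ)`. -/
def chainsAct (n : ℕ) {H : OrbitCat G} (γ : FundamentalGroup₀ (fixed X H : SSet.{u})) :
    (coverChains X n).obj (op H) ⟶ (coverChains X n).obj (op H) :=
  AddCommGrpCat.ofHom (chainsMap (coverAct γ) n)

/-- The group `Hom_{πX}(C_n(X̃), M₀)` of the natural transformations `C_n(X̃) ⟶ M₀` respecting the
actions of `π₁(X^H, v)` for all `H`. -/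
def equivariantHom (n : ℕ) : AddSubgroup (coverChains X n ⟶ baseCoeff X M) where
  carrier := {f | ∀ (H : OrbitCat G) (γ : FundamentalGroup₀ (fixed X H : SSet.{u})),
    chainsAct X n γ ≫ f.app (op H) = f.app (op H) ≫ coeffAct X M γ}
  zero_mem' H γ := by simp
  add_mem' {f f'} hf hf' H γ := by
    simp [hf H γ, hf' H γ]
  neg_mem' {f} hf H γ := by
    simp [hf H γ]

lemma chainsAct_boundary (n : ℕ) {H : OrbitCat G}
    (γ : FundamentalGroup₀ (fixed X H : SSet.{u})) :
    chainsAct X (n + 1) γ ≫ (coverBoundary X n).app (op H) =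
      (coverBoundary X n).app (op H) ≫ chainsAct X n γ :=
  congrArg AddCommGrpCat.ofHom (boundary_chainsMap (coverAct γ) n)

/-- The coboundary `f ↦ f ∘ ∂`. -/
def coverCoboundary (n : ℕ) : equivariantHom X M n →+ equivariantHom X M (n + 1) where
  toFun f := ⟨coverBoundary X n ≫ f.1, fun H γ => by
    have h := f.2 H γ
    rw [NatTrans.comp_app, ← Category.assoc, chainsAct_boundary, Category.assoc, h,
      Category.assoc]⟩
  map_zero' := Subtype.ext Limits.comp_zero
  map_add' f f' := Subtype.ext (Preadditive.comp_add _ _ _ _ _ _)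

/-- The cochain complex `Hom_{πX}(C_•(X̃), M₀)`. -/
def coverComplex : CochainComplex AddCommGrpCat.{u} ℕ :=
  CochainComplex.of (fun n => AddCommGrpCat.of (equivariantHom X M n))
    (fun n => AddCommGrpCat.ofHom (coverCoboundary X M n))
    (fun n => by
      refine ConcreteCategory.hom_ext _ _ fun (f : equivariantHom X M n) => Subtype.ext ?_
      change coverBoundary X (n + 1) ≫ coverBoundary X n ≫ f.1 = 0
      rw [← Category.assoc, coverBoundary_coverBoundary, Limits.zero_comp])

/-- The equivariant cohomology `H^n_{πX,G}(X̃; M₀)`. -/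
def coverCohomology (n : ℕ) : AddCommGrpCat.{u} := (coverComplex X M).homology n

end CoverCohomology

end BredonIllman

namespace BredonIllman

/-! The two cochain complexes are already isomorphic, degree by degree, so nothing about homology is
needed beyond functoriality. Equivariant `n`-simplices of type `H` are the `n`-simplices `x` of
`X^H`. In the universal covering complex of `X^H` the simplices over `x` are the pairs `(γ, x)`,
permuted simply transitively by `π₁(X^H, v)`. Hence `C_n(X̃)(G/H)` is a free module over the group
ring, with basis the `(1, x)` for `x` nondegenerate, and an equivariant homomorphism to `M(v_H)`
amounts to a choice of values `f(1, x)`, which is a normalized cochain `σ ↦ f(1, σ')`. Its values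
lie in the right groups because the only vertex is `v`, so that `σ_H = v_H`.

Two compatibilities remain. First, naturality in `G/H` is the invariance condition `f(η) = M(g_*)
f(τ)`: after identifying vertices with base points, `g_*` is `[ĝ, k]` (`fromBase_comp_compatHom`).
Second, `f ∘ ∂` is the twisted coboundary: `∂₀(1, x) = ([e], ∂₀x)` with `e` the edge of `x` from `0`
to `1`, equivariance gives `f([e], ∂₀x) = M(b[e]) f(1, ∂₀x)` (`equivariantHom_gen`), and `b[e]` is
`σ_*` (`fromBase_comp_vertexHom`).

For the inverse, a cochain `F` is extended by `(γ, x) ↦ M(bγ) F(x)`. Equivariance holds because `b`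
is a homomorphism (`familyToCover_mem`). Naturality also involves the coordinate `γ` and needs `b`
to commute with translation along `ĝ` (`loopHom_map_comp`). -/

section Comparison

/-! ### Initial vertices, base points and loops. -/

variable {G : Type u} [Group G] {X : Action SSet.{u} G}

lemma pt_eq [Unique (X.V _⦋0⦌)] {H : OrbitCat G} (x y : EquivSimplex X H 0) : x = y :=
  simplexEquiv.injective (Subsingleton.elim _ _)

/-- The initial vertex of `σ` and `v_H` are equal but not definitionally so; values in `M(σ_H)` and
in `M(v_H)` therefore have different types and are compared by transport along this equality. -/
lemma vertex_eq [Unique (X.V _⦋0⦌)] {H : OrbitCat G} {n : ℕ} (σ : EquivSimplex X H n) :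
    (⟨H, simplexEquiv.symm default⟩ : FundGroupoid X) = σ.vertex := congrArg (FundGroupoid.mk H) (pt_eq _ _)

variable [IsGKan X]

/-- The two components of a path have types that depend only on the orbits, not on the end points.
So paths between different names of the same objects can be compared componentwise, and equality of
the components gives equality of the classes up to transport. The end points are kept as free
variables so that their equalities can be eliminated. -/
lemma homMk_comp_eqToHom {H K : OrbitCat G} {x x' : EquivSimplex X H 0} {y y' : EquivSimplex X K 0}
    (p : FundGroupoid.Path (⟨H, x⟩ : FundGroupoid X) ⟨K, y⟩)
    (p' : FundGroupoid.Path (⟨H, x'⟩ : FundGroupoid X) ⟨K, y'⟩)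
    (hx : x = x') (hy : y = y') (horb : p.orb = p'.orb) (hpath : p.path = p'.path) :
    eqToHom (congrArg (FundGroupoid.mk H) hx) ≫ FundGroupoid.homMk p' =
      FundGroupoid.homMk p ≫ eqToHom (congrArg (FundGroupoid.mk K) hy) := by
  subst hx hy
  obtain rfl : p = p' := FundGroupoid.Path.ext horb hpath
  rw [eqToHom_refl, eqToHom_refl, Category.id_comp, Category.comp_id]

variable [Unique (X.V _⦋0⦌)]

/-- The identification of `v_H` with the initial vertex of an equivariant simplex of type `H`. -/
noncomputable def EquivSimplex.fromBase {H : OrbitCat G} {n : ℕ} (σ : EquivSimplex X H n) :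
    basePoint X H ⟶ σ.vertex := eqToHom (vertex_eq σ)

instance {H : OrbitCat G} {n : ℕ} (σ : EquivSimplex X H n) : IsIso σ.fromBase := by
  unfold EquivSimplex.fromBase
  infer_instance

/-- Both sides are represented by the same equivariant `1`-simplex, the edge of `σ` from `0` to
`θ(0)`: read in `ΠX` it is a morphism between initial vertices, read in `X^H` it is a loop at `v`.
For `θ = δ₀` this matches `σ_*` with the loop that twists `∂₀` in the covering complex. -/
lemma fromBase_comp_vertexHom {H : OrbitCat G} {m n : ℕ} (σ : EquivSimplex X H n)
    (τ : EquivSimplex X H m) (θ : ⦋m⦌ ⟶ ⦋n⦌) (h : σ.face θ = τ.pull (𝟙 H)) :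
    σ.fromBase ≫ vertexHom σ τ (𝟙 H) θ h =
      loopHom H (edgeLoop (simplexEquiv σ) 0 (θ 0) (Fin.zero_le _)) ≫ τ.fromBase := by
  -- `edgeLoop` is by definition the class of an explicit `1`-simplex, so its image under `loopHom`
  -- unfolds to the class of a `loopPath`.
  refine homMk_comp_eqToHom (loopPath _) _ (pt_eq _ _) (pt_eq _ _) rfl ?_
  refine simplexEquiv.injective ((Equiv.apply_symm_apply _ _).trans ?_)
  exact (simplexEquiv_face _ _).symm

/-- The morphism `[ĝ, k] : v_H ⟶ v_K`. -/
def baseHom {H K : OrbitCat G} (g : H ⟶ K) : basePoint X H ⟶ basePoint X K :=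
  FundGroupoid.homMk (basePath g)

/-- Both morphisms have orbit component `ĝ` and a degenerate path, `η_H ∘ (id × σ_0)` on one side
and `s_0 v` on the other; these agree since `X^H` has only one vertex. This converts the invariance
condition on cochains into naturality with respect to `M₀(ĝ)`. -/
lemma fromBase_comp_compatHom {H K : OrbitCat G} {n : ℕ} (η : EquivSimplex X H n)
    (τ : EquivSimplex X K n) (g : H ⟶ K) (h : τ.pull g = η) :
    η.fromBase ≫ compatHom η τ g h = baseHom g ≫ τ.fromBase := by
  refine homMk_comp_eqToHom (basePath g) _ (pt_eq _ _) (pt_eq _ _) rfl ?_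
  refine simplexEquiv.injective ((Equiv.apply_symm_apply _ _).trans ?_)
  refine Eq.trans ?_ (simplexEquiv_face _ _).symm
  exact congrArg ((fixed X H : SSet.{u}).σ 0) (Subsingleton.elim _ _)

/-- Represent `γ` by an equivariant `1`-simplex `τ` of type `K`. Up to the identifications with base
points, each side goes from the initial vertex of `τ ∘ (ĝ × id)` to the end vertex of `τ`, either
along the edge and then through `ĝ`, or in the other order. By `vertexHom_comp` both are the single
morphism attached to `ĝ` and `δ₀`. -/
lemma loopHom_map_comp {H K : OrbitCat G} (g : H ⟶ K)
    (γ : FundamentalGroup₀ (fixed X K : SSet.{u})) :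
    loopHom H (FundamentalGroup₀.map (translate X g) γ) ≫ baseHom g =
      baseHom g ≫ loopHom K γ := by
  obtain ⟨x, rfl⟩ := loopClass_surjective γ
  obtain ⟨τ, rfl⟩ := simplexEquiv.surjective x
  -- A `1`-simplex is its own edge from `0` to `1`.
  have hid : ∀ {L : OrbitCat G} (ρ : EquivSimplex X L 1),
      loopClass (simplexEquiv ρ) = edgeLoop (simplexEquiv ρ) 0 1 (Fin.zero_le _) := fun ρ => by
    refine congrArg loopClass ((smap_id _ _).symm.trans ?_)
    exact congrArg (fun θ : ⦋1⦌ ⟶ ⦋1⦌ => (fixed X _ : SSet.{u}).map θ.op (simplexEquiv ρ))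
      (SimplexCategory.Hom.ext_one_left _ _ rfl rfl)
  -- Since `δ₀(0) = 1`, the edge attached to the face `δ₀` of `ρ` is all of `ρ`, so the loop of `ρ`
  -- becomes the morphism from its initial to its end vertex.
  have e : ∀ {L : OrbitCat G} (ρ : EquivSimplex X L 1),
      loopHom L (loopClass (simplexEquiv ρ)) ≫ (ρ.face (SimplexCategory.δ 0)).fromBase =
        ρ.fromBase ≫ vertexHom ρ (ρ.face (SimplexCategory.δ 0)) (𝟙 L) (SimplexCategory.δ 0)
          (EquivSimplex.pull_id _).symm := fun ρ => by
    rw [fromBase_comp_vertexHom, hid]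
    rfl
  have hp : (τ.face (SimplexCategory.δ 0)).pull g =
      (τ.pull g).face (SimplexCategory.δ 0) := (EquivSimplex.pull_face _ _ _).symm
  -- Composing with the isomorphism from `v_K` to the end vertex of `τ` makes the preceding
  -- identities applicable. The identifications then move to the far left on both sides.
  rw [FundamentalGroup₀.map_loopClass, ← simplexEquiv_pull,
    ← cancel_mono (τ.face (SimplexCategory.δ 0)).fromBase, Category.assoc, Category.assoc, e,
    ← fromBase_comp_compatHom _ _ g hp, ← Category.assoc, e, Category.assoc,
    ← Category.assoc _ τ.fromBase, ← fromBase_comp_compatHom _ _ g rfl, Category.assoc, compatHom_eq, compatHom_eq,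
    vertexHom_comp, vertexHom_comp]
  -- The two composites now differ only by identity factors, on either side of `ĝ` and of `δ₀`.
  congr 1

/-! ### From homomorphisms on the chains of the covering to invariant cochains. -/

variable (M : (FundGroupoid X)ᵒᵖ ⥤ AddCommGrpCat.{u})

variable {M} in
/-- The component at `G/H` of a natural transformation on the chains of `X̃`. -/
noncomputable def chainsEval {n : ℕ} (f : coverChains X n ⟶ baseCoeff X M) (H : OrbitCat G) :
    Chains (cover (fixed X H : SSet.{u})) n →+ M.obj (op (basePoint X H)) :=
  (f.app (op H)).hom

/-- The cochain `σ ↦ f(1, σ')` of a homomorphism `f` on the chains of `X̃`. -/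
noncomputable def coverToFamily (n : ℕ) : (coverChains X n ⟶ baseCoeff X M) →+ Family M n where
  toFun f H σ := M.map (inv σ.fromBase).op
    (chainsEval f H (gen (coverPt 1 (simplexEquiv σ))))
  map_zero' := by
    funext H σ
    exact map_zero (M.map (inv σ.fromBase).op).hom
  map_add' f f' := by
    funext H σ
    exact map_add (M.map (inv σ.fromBase).op).hom _ _

variable {M}

/-- Removes the inverse transport from the definition of `coverToFamily`. Together with
`map_fromBase_injective` it allows every identity in `M(σ_H)` to be checked in `M(v_H)`, where the
homomorphism takes its values. -/
lemma map_fromBase_coverToFamily {n : ℕ} (f : coverChains X n ⟶ baseCoeff X M) {H : OrbitCat G}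
    (σ : EquivSimplex X H n) : M.map σ.fromBase.op (coverToFamily M n f H σ) =
      chainsEval f H (gen (coverPt 1 (simplexEquiv σ))) := by
  refine (M_map_comp _ _ _).symm.trans ?_
  rw [IsIso.hom_inv_id]
  exact M_map_id _

lemma map_fromBase_injective {H : OrbitCat G} {n : ℕ} (σ : EquivSimplex X H n) :
    Function.Injective (M.map σ.fromBase.op) := by
  intro a b h
  have := congrArg (M.map (inv σ.fromBase).op) h
  rwa [← M_map_comp, ← M_map_comp, IsIso.inv_hom_id, M_map_id, M_map_id] at this

/-- Degeneracies of the covering complex leave the group coordinate unchanged. -/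
lemma coverPt_mem_degenerate {Y : SSet.{u}} [SSet.KanComplex Y] [Unique (Y _⦋0⦌)] {n : ℕ}
    (γ : FundamentalGroup₀ Y) {x : Y _⦋n⦌} (hx : x ∈ Y.degenerate n) :
    coverPt γ x ∈ (cover Y).degenerate n := by
  obtain _ | n := n
  -- There are no degenerate simplices in dimension `0`; above it, degenerate means lying in the
  -- image of some `s_i`.
  · simp at hx
  rw [SSet.degenerate_eq_iUnion_range_σ, Set.mem_iUnion] at hx ⊢
  obtain ⟨i, y, rfl⟩ := hx
  exact ⟨i, coverPt γ y, cover_σ γ y i⟩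

/-- Project the degeneracy to its second coordinate. With the previous lemma, `(γ, x)` is
nondegenerate exactly when `x` is, which is what makes normalized cochains on the two sides
correspond. -/
lemma mem_degenerate_of_coverPt {Y : SSet.{u}} [SSet.KanComplex Y] [Unique (Y _⦋0⦌)] {n : ℕ}
    {γ : FundamentalGroup₀ Y} {x : Y _⦋n⦌} (hx : coverPt γ x ∈ (cover Y).degenerate n) :
    x ∈ Y.degenerate n := by
  obtain _ | n := n
  · simp at hx
  rw [SSet.degenerate_eq_iUnion_range_σ, Set.mem_iUnion] at hx ⊢
  obtain ⟨i, ⟨β, y⟩, h⟩ := hx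
  exact ⟨i, y, congrArg Prod.snd h⟩

/-- An equivariant homomorphism is determined by its values on the simplices `(1, x)`. -/
lemma equivariantHom_gen {n : ℕ} (f : equivariantHom X M n) {H : OrbitCat G}
    (γ : FundamentalGroup₀ (fixed X H : SSet.{u})) (x : (fixed X H : SSet.{u}) _⦋n⦌) :
    chainsEval f.1 H (gen (coverPt γ x)) =
      M.map (loopHom H γ).op
        (chainsEval f.1 H (gen (coverPt 1 x))) := by
  -- The element `γ` acts by right multiplication with `γ⁻¹`, so it sends `(γ, x)` to `(1, x)`.
  -- Equivariance at `(γ, x)` thus reads `f(1, x) = M(bγ)⁻¹ f(γ, x)`, to be solved for `f(γ, x)`.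
  have h := congrArg (fun φ => φ (gen (Y := cover (fixed X H : SSet.{u})) (coverPt γ x))) (f.2 H γ)
  have h' : chainsEval f.1 H (gen (coverPt 1 x)) =
      M.map (loopAut H γ).inv.op
        (chainsEval f.1 H (gen (coverPt γ x))) := by
    refine Eq.trans (congrArg (chainsEval f.1 H) ?_) h
    refine Eq.trans ?_ (chainsMap_gen (coverAct γ) _).symm
    exact congrArg (fun β => gen (Y := cover (fixed X H : SSet.{u})) (coverPt β x))
      (mul_inv_cancel γ).symm
  rw [h']
  refine Eq.symm ((M_map_comp _ _ _).symm.trans ?_)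
  refine Eq.trans ?_ (M_map_id _)
  exact congrArg (fun φ => M.map (Quiver.Hom.op φ) (chainsEval f.1 H (gen (coverPt γ x))))
    (show basePoint X H ≅ basePoint X H from loopAut H γ).hom_inv_id

/-- Vanishing on degenerate simplices holds because `(1, x)` is then zero in the chains. Invariance
is naturality along `ĝ` evaluated at `(1, τ')`: translation fixes the coordinate `1` and sends `τ'`
to `η'`, so it yields `(1, η')`. -/
lemma coverToFamily_mem {n : ℕ} (f : equivariantHom X M n) :
    coverToFamily M n f.1 ∈ invariantCochains M n := by
  refine ⟨fun H σ hσ => ?_, fun H K η τ g h => ?_⟩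
  · apply map_fromBase_injective σ
    rw [map_fromBase_coverToFamily, gen_eq_zero (coverPt_mem_degenerate _ hσ), map_zero, map_zero]
  · apply map_fromBase_injective η
    rw [map_fromBase_coverToFamily, ← M_map_comp, fromBase_comp_compatHom, M_map_comp,
      map_fromBase_coverToFamily]
    have := congrArg (fun φ => φ (gen (Y := cover (fixed X K : SSet.{u}))
      (coverPt 1 (simplexEquiv τ)))) (f.1.naturality g.op)
    refine Eq.trans (congrArg (chainsEval f.1 H) ?_) this
    refine Eq.trans ?_ (chainsMap_gen (coverMap (translate X g)) _).symm
    rw [coverMap_app, map_one, ← simplexEquiv_pull, h]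

/-- The `j`-th face of `(1, x)` is `([e], ∂_j x)`, with `e` the edge of `x` from `0` to `δ_j(0)`;
this edge is degenerate for `j > 0`. Writing the coboundary with `vertexHom` for every face, as in
`coboundary_eq`, lets all `j` be treated alike: equivariance extracts `M(b[e])`, and `b[e]` is that
morphism. -/
lemma coverToFamily_coboundary {n : ℕ} (f : equivariantHom X M n) :
    coverToFamily M (n + 1) (coverCoboundary X M n f).1 =
      coboundary M n (coverToFamily M n f.1) := by
  funext H σ
  apply map_fromBase_injective σ
  rw [map_fromBase_coverToFamily, coboundary_eq, map_sum]
  refine (congrArg (chainsEval f.1 H) (boundary_gen _)).trans ((map_sum _ _ _).trans ?_)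
  refine Finset.sum_congr rfl fun j _ => ?_
  rw [map_zsmul, map_zsmul, ← M_map_comp, fromBase_comp_vertexHom, M_map_comp,
    map_fromBase_coverToFamily, ← equivariantHom_gen, simplexEquiv_face]
  -- What remains is the group coordinate of the face, the loop `[e]` times the initial coordinate
  -- `1`.
  refine congrArg (fun β => (-1 : ℤ) ^ j.val • chainsEval f.1 H (gen (coverPt β _))) ?_
  exact mul_one _

/-! ### The inverse: extending a cochain over the group coordinate. -/

/-- The value of the homomorphism corresponding to a cochain on a simplex `(γ, x)`. -/
noncomputable def familyValue {n : ℕ} (F : Family M n) {H : OrbitCat G}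
    (p : (cover (fixed X H : SSet.{u})) _⦋n⦌) : M.obj (op (basePoint X H)) :=
  M.map (loopHom H p.1).op (M.map (simplexEquiv.symm p.2).fromBase.op (F H (simplexEquiv.symm p.2)))

/-- The homomorphism on the chains of `X̃(G/H)` corresponding to a cochain. -/
noncomputable def familyLift {n : ℕ} (F : Family M n) (H : OrbitCat G) :
    Chains (cover (fixed X H : SSet.{u})) n →+ M.obj (op (basePoint X H)) :=
  FreeAbelianGroup.lift fun p => familyValue F p.1

/-- The lift is prescribed on nondegenerate generators only. Since `F` vanishes on degenerate
simplices, the same formula holds on all simplices, so translates and other images need not be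
checked for degeneracy. -/
lemma familyLift_gen {n : ℕ} {F : Family M n} (hF : F ∈ cochains M n) {H : OrbitCat G}
    (p : (cover (fixed X H : SSet.{u})) _⦋n⦌) : familyLift F H (gen p) = familyValue F p := by
  by_cases h : p ∈ (cover (fixed X H : SSet.{u})).nonDegenerate n
  · exact (congrArg _ (gen_coe ⟨p, h⟩)).trans (FreeAbelianGroup.lift_apply_of _ _)
  · have h' : p ∈ (cover (fixed X H : SSet.{u})).degenerate n := not_not.1 h
    obtain ⟨γ, x⟩ := p
    have hx : (simplexEquiv.symm x : EquivSimplex X H n).IsDegenerate := by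
      unfold EquivSimplex.IsDegenerate
      rw [Equiv.apply_symm_apply]
      exact mem_degenerate_of_coverPt h'
    rw [gen_eq_zero h', map_zero]
    unfold familyValue
    rw [hF H _ hx, map_zero, map_zero]

/-- Translation along `ĝ` sends `(γ, τ')` to `(g_*γ, η')` with `η = τ ∘ (ĝ × id)`. Invariance of `F`
replaces `F(η)` by `M(g_*) F(τ)`, and `loopHom_map_comp` exchanges `b(g_*γ)` with `bγ` across `[ĝ,
k]`. -/
lemma familyLift_naturality {n : ℕ} {F : Family M n} (hF : F ∈ invariantCochains M n)
    {H K : OrbitCat G} (g : H ⟶ K) :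
    (familyLift F H).comp (chainsMap (coverMap (translate X g)) n) =
      (M.map (baseHom g).op).hom.comp (familyLift F K) := by
  refine chains_hom_ext fun p => ?_
  rw [AddMonoidHom.comp_apply, AddMonoidHom.comp_apply, chainsMap_gen, familyLift_gen hF.1,
    familyLift_gen hF.1]
  obtain ⟨γ, x⟩ := p
  obtain ⟨τ, rfl⟩ := simplexEquiv.surjective x
  change M.map (loopHom H (FundamentalGroup₀.map (translate X g) γ)).op
    (M.map (simplexEquiv.symm ((translate X g).app _ (simplexEquiv τ))).fromBase.op
      (F H (simplexEquiv.symm ((translate X g).app _ (simplexEquiv τ))))) =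
    M.map (baseHom g).op (M.map (loopHom K γ).op
      (M.map (simplexEquiv.symm (simplexEquiv τ)).fromBase.op
        (F K (simplexEquiv.symm (simplexEquiv τ)))))
  -- Recognizing the translated simplex as that of `τ.pull g` makes the invariance of `F`
  -- applicable; the two sides are then `M` of two morphisms `v_H ⟶ v_K`, applied to the same
  -- element of `M(v_K)`.
  rw [← simplexEquiv_pull, Equiv.symm_apply_apply, Equiv.symm_apply_apply,
    hF.2 H K (τ.pull g) τ g rfl, ← M_map_comp (τ.pull g).fromBase, fromBase_comp_compatHom,
    M_map_comp, ← M_map_comp, ← M_map_comp (baseHom g)]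
  exact congrArg (fun φ => M.map φ.op (M.map τ.fromBase.op (F K τ))) (loopHom_map_comp g γ)

/-- The natural transformation on the chains of `X̃` corresponding to an invariant cochain. -/
noncomputable def familyToCover {n : ℕ} {F : Family M n} (hF : F ∈ invariantCochains M n) :
    coverChains X n ⟶ baseCoeff X M where
  app H := AddCommGrpCat.ofHom (familyLift F H.unop)
  naturality _ _ g := congrArg AddCommGrpCat.ofHom (familyLift_naturality hF g.unop)

/-- At `(β, x)` the claim becomes `M(b(βγ⁻¹)) = M(bγ)⁻¹ M(bβ)`, which holds because `b` is a
homomorphism and `M` is contravariant. -/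
lemma familyToCover_mem {n : ℕ} {F : Family M n} (hF : F ∈ invariantCochains M n) :
    familyToCover hF ∈ equivariantHom X M n := by
  intro H γ
  refine congrArg AddCommGrpCat.ofHom (a₁ := (familyLift F H).comp (chainsMap (coverAct γ) n))
    (a₂ := (M.map (show basePoint X H ≅ basePoint X H from loopAut H γ).inv.op).hom.comp
      (familyLift F H)) (chains_hom_ext fun p => ?_)
  rw [AddMonoidHom.comp_apply, AddMonoidHom.comp_apply, chainsMap_gen, familyLift_gen hF.1,
    familyLift_gen hF.1]
  obtain ⟨β, x⟩ := p
  refine Eq.trans ?_ (M_map_comp _ _ _)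
  refine congrArg (fun φ => M.map (Quiver.Hom.op φ) _) ?_
  -- A product in `π₁` composes its right factor first, so `βγ⁻¹` is `γ⁻¹` followed by `β`. Passing
  -- to `Aut(v_H)` makes the inverse available.
  change loopHom H (β * γ⁻¹) = (loopAut H γ).inv ≫ loopHom H β
  rw [← loopAut_hom, ← loopAut_hom, map_mul, map_inv]
  rfl

/-- On the simplices `(1, x)` the twisting factor is `M(b(1)) = id`, so restricting the extension
recovers `F`. -/
lemma coverToFamily_familyToCover {n : ℕ} {F : Family M n} (hF : F ∈ invariantCochains M n) :
    coverToFamily M n (familyToCover hF) = F := by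
  funext H σ
  apply map_fromBase_injective σ
  rw [map_fromBase_coverToFamily]
  refine (familyLift_gen hF.1 _).trans ?_
  change M.map (loopHom H 1).op (M.map (simplexEquiv.symm (simplexEquiv σ)).fromBase.op
    (F H (simplexEquiv.symm (simplexEquiv σ)))) = _
  rw [Equiv.symm_apply_apply, map_one]
  exact M_map_id _

/-! ### The isomorphism of cochain complexes and the theorem. -/

variable (X M) in
/-- The isomorphism `Hom_{πX}(C_n(X̃), M₀) ≃ S^n_G(X; M)`. -/
noncomputable def coverEquiv (n : ℕ) : equivariantHom X M n ≃+ invariantCochains M n :=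
  AddEquiv.ofBijective
    (((coverToFamily M n).comp (equivariantHom X M n).subtype).codRestrict
      (invariantCochains M n) coverToFamily_mem) <| by
    -- Injectivity: the simplices `(1, x)` generate the chains under `π₁(X^H, v)`, so the values
    -- there determine `f`. Surjectivity: `familyToCover` supplies a preimage.
    refine ⟨fun f f' h => Subtype.ext ?_, fun F =>
      ⟨⟨familyToCover F.2, familyToCover_mem F.2⟩, Subtype.ext (coverToFamily_familyToCover F.2)⟩⟩
    have h' : coverToFamily M n f.1 = coverToFamily M n f'.1 := congrArg Subtype.val h
    refine NatTrans.ext (funext fun H => ConcreteCategory.hom_ext _ _ fun c => ?_)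
    refine DFunLike.congr_fun (chains_hom_ext (f := chainsEval f.1 H.unop)
      (g := chainsEval f'.1 H.unop) fun p => ?_) c
    obtain ⟨γ, x⟩ := p
    obtain ⟨σ, rfl⟩ := simplexEquiv.surjective x
    refine (equivariantHom_gen f γ _).trans (Eq.trans ?_ (equivariantHom_gen f' γ _).symm)
    rw [← map_fromBase_coverToFamily, ← map_fromBase_coverToFamily, h']

variable (X M) in
/-- The isomorphism of cochain complexes `Hom_{πX}(C_•(X̃), M₀) ≅ S^•_G(X; M)`. -/
noncomputable def complexIso : coverComplex X M ≅ bredonIllmanComplex X M :=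
  HomologicalComplex.Hom.isoOfComponents (fun n => (coverEquiv X M n).toAddCommGrpIso) <| by
    -- Commutation with the differentials is needed only from degree `n` to `n + 1`, where it is
    -- `coverToFamily_coboundary`.
    rintro n _ rfl
    dsimp only [coverComplex, bredonIllmanComplex]
    rw [CochainComplex.of_d, CochainComplex.of_d]
    exact ConcreteCategory.hom_ext _ _ fun f =>
      Subtype.ext (coverToFamily_coboundary f).symm

end Comparison

end BredonIllman

theorem theorem4p2 {G : Type u} [Group G] (X : Action SSet.{u} G) [BredonIllman.IsGKan X]
    [Unique (X.V _⦋0⦌)] (M : (BredonIllman.FundGroupoid X)ᵒᵖ ⥤ AddCommGrpCat.{u}) (n : ℕ) :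
    Nonempty (BredonIllman.bredonIllmanCohomology X M n ≅ BredonIllman.coverCohomology X M n) :=
  -- `complexIso` starts at the covering complex, hence the inverse.
  ⟨((HomologicalComplex.homologyFunctor _ _ n).mapIso (BredonIllman.complexIso X M)).symm⟩
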